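/- A Davenport–Schinzel sequence of order $3$ is a finite sequence in which no two adjacent symbols are equal and which contains no (not necessarily contiguous) alternating subsequence $a\,b\,a\,b\,a$ with $a\neq b$. Let $\lambda_3(n)$ denote the maximum length of a Davenport–Schinzel sequence of order $3$ on $n$ distinct symbols. Define the Ackermann hierarchy by $A_1(n)=2n$ and $A_k(n)=A_{k-1}^{(n)}(1)$ for $k\ge 2$, $n\ge 0$, where $f^{(n)}$ is the $n$-fold composition of $f$; let $A(n)=A_n(3)$ for $n\ge 1$, and let $\alpha(x)=\min\{n\ge 1 : A(n)\ge x\}$ be the inverse Ackermann function. Then the limit of $\lambda_3(n)/\bigl(n\,\alpha(n)\bigr)$ as $n\to\infty$ exists, and $$\lim_{n\to\infty}\frac{\lambda_3(n)}{n\,\alpha(n)}=2 .$$ -/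

import Mathlib

open Filter Topology

namespace DavenportSchinzel

/-- A sequence `S = a₁ a₂ a₃ …` is `r`-sparse if `aᵢ ≠ aⱼ` whenever `1 ≤ |j - i| ≤ r - 1`. -/
def IsSparse {β : Type*} (r : ℕ) (S : List β) : Prop :=
  ∀ (i j : ℕ) (_ : i < j) (_ : j < i + r) (hj : j < S.length), S[i] ≠ S[j]

/-- The sequence `S` contains the pattern `u`: some (not necessarily contiguous) subsequence of `S`
is obtained from `u` by a one-to-one renaming of the symbols of `u`. -/
def Contains {β γ : Type*} (u : List β) (S : List γ) : Prop :=
  ∃ f : β → γ, Set.InjOn f {x | x ∈ u} ∧ (u.map f).Sublist S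

/-- The alternation `0 1 0 1 0 …` of length `m`. -/
def alternation (m : ℕ) : List ℕ :=
  (List.range m).map (fun i => i % 2)

/-- Davenport–Schinzel sequences of order `s`: no two adjacent symbols are equal, and there is no
alternation `a … b … a … b …` of length `s + 2` with `a ≠ b`. -/
def IsDS {β : Type*} (s : ℕ) (S : List β) : Prop :=
  IsSparse 2 S ∧ ¬ Contains (alternation (s + 2)) S

/-- The lengths of the Davenport–Schinzel sequences of order `s` on exactly `n` distinct symbols
(the symbols are taken to be natural numbers). -/
def dsLengths (s n : ℕ) : Set ℕ :=
  {L | ∃ S : List ℕ, IsDS s S ∧ S.toFinset.card = n ∧ S.length = L}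

/-- `λ_s(n)`: the maximum length of a Davenport–Schinzel sequence of order `s` on `n` distinct
symbols. For `s ≥ 1` it really is a maximum, see `isGreatest_lambda`. -/
noncomputable def lambda (s n : ℕ) : ℕ :=
  sSup (dsLengths s n)

/-- The Ackermann hierarchy `A_k`, `k ≥ 1`: `A₁(n) = 2 n`, and `A_k(n) = A_{k-1}^{(n)}(1)` for
`k ≥ 2`. The value at `k = 0` is a placeholder that is never used. -/
def ackHierarchy : ℕ → ℕ → ℕ
  | 0 => fun _ => 0
  | 1 => fun n => 2 * n
  | k + 2 => fun n => (ackHierarchy (k + 1))^[n] 1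

/-- The Ackermann function `A(n) = A_n(3)`, `n ≥ 1`. -/
def ackermann (n : ℕ) : ℕ :=
  ackHierarchy n 3

/-- The inverse Ackermann function `α(x) = min {n ≥ 1 | A(n) ≥ x}`. The set is never empty, see
`alpha_spec`. -/
noncomputable def alpha (x : ℝ) : ℕ :=
  sInf {n : ℕ | 1 ≤ n ∧ x ≤ (ackermann n : ℝ)}

/-! ### The minimum and the maximum in these definitions exist -/

theorem ackHierarchy_strictMono (k : ℕ) :
    StrictMono (ackHierarchy (k + 1)) ∧ ∀ m, 1 ≤ m → m < ackHierarchy (k + 1) m := by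
  induction k with
  | zero =>
    refine ⟨fun a b h => ?_, fun m hm => ?_⟩
    · simp only [ackHierarchy]; omega
    · simp only [ackHierarchy]; omega
  | succ k ih =>
    have hs : ∀ n, ackHierarchy (k + 2) (n + 1) =
        ackHierarchy (k + 1) (ackHierarchy (k + 2) n) := fun n => by
      simp only [ackHierarchy, Function.iterate_succ_apply']
    have hlt : ∀ n, n < ackHierarchy (k + 2) n := by
      intro n
      induction n with
      | zero => simp [ackHierarchy]
      | succ n ihn =>
        have := ih.2 (ackHierarchy (k + 2) n) (by omega)
        rw [hs]; omega
    refine ⟨strictMono_nat_of_lt_succ fun n => ?_, fun m _ => hlt m⟩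
    rw [hs]
    exact ih.2 _ (Nat.lt_of_le_of_lt (Nat.zero_le n) (hlt n))

theorem lt_ackermann (n : ℕ) : n + 1 < ackermann (n + 1) := by
  induction n with
  | zero => decide
  | succ n ih =>
    have h4 : ∀ k, ackHierarchy (k + 1) 1 = 2 ∧ ackHierarchy (k + 1) 2 = 4 := by
      intro k
      induction k with
      | zero => simp [ackHierarchy]
      | succ k ihk =>
        simp only [ackHierarchy, Function.iterate_succ_apply', Function.iterate_zero, id] at ihk ⊢
        exact ⟨ihk.1, by rw [ihk.1, ihk.2]⟩
    have h : ackermann (n + 2) = ackHierarchy (n + 1) 4 := by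
      rw [← (h4 (n + 1)).2]
      simp only [ackermann, ackHierarchy, Function.iterate_succ_apply']
    have := (ackHierarchy_strictMono n).1 (show 3 < 4 by norm_num)
    rw [h]
    unfold ackermann at ih
    omega

theorem alpha_spec (x : ℝ) :
    IsLeast {n : ℕ | 1 ≤ n ∧ x ≤ (ackermann n : ℝ)} (alpha x) := by
  have hne : {n : ℕ | 1 ≤ n ∧ x ≤ (ackermann n : ℝ)}.Nonempty := by
    obtain ⟨m, hm⟩ := exists_nat_ge x
    refine ⟨m + 1, by omega, hm.trans ?_⟩
    have := lt_ackermann m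
    exact_mod_cast (by omega : m ≤ ackermann (m + 1))
  exact ⟨Nat.sInf_mem hne, fun _ hn => Nat.sInf_le hn⟩

/-- Cut a sequence into consecutive pairs, dropping a last unpaired symbol. -/
def pairs {β : Type*} : List β → List (β × β)
  | a :: b :: l => (a, b) :: pairs l
  | _ => []

theorem pairs_facts {β : Type*} (l : List β) :
    ((pairs l).flatMap fun p => [p.1, p.2]).Sublist l ∧ l.length ≤ 2 * (pairs l).length + 1 ∧
      (IsSparse 2 l → ∀ p ∈ pairs l, p.1 ≠ p.2) := by
  induction l using pairs.induct with
  | case1 a b l ih =>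
    obtain ⟨h1, h2, h3⟩ := ih
    refine ⟨?_, ?_, ?_⟩
    · simpa [pairs] using h1
    · simp only [pairs, List.length_cons]; omega
    · intro hs p hp
      simp only [pairs, List.mem_cons] at hp
      rcases hp with rfl | hp
      · exact hs 0 1 (by omega) (by omega) (by simp)
      · refine h3 (fun i j hij hj hjl => ?_) p hp
        have := hs (i + 2) (j + 2) (by omega) (by omega) (by simpa using hjl)
        simpa using this
  | case2 l h =>
    match l, h with
    | [], _ => simp [pairs]
    | [a], _ => simp [pairs]
    | a :: b :: l, h => exact absurd rfl (h a b l)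

theorem length_le_of_isDS {s : ℕ} {S : List ℕ} (h : IsDS s S) :
    S.length ≤ 2 * ((S.toFinset.card * S.toFinset.card) * (s + 2)) + 1 := by
  obtain ⟨h1, h2, h3⟩ := pairs_facts S
  have hmem : ∀ p ∈ pairs S, p ∈ S.toFinset ×ˢ S.toFinset := by
    intro p hp
    have hm : ∀ x ∈ [p.1, p.2], x ∈ S := fun x hx =>
      h1.subset (List.mem_flatMap.2 ⟨p, hp, hx⟩)
    simp only [Finset.mem_product, List.mem_toFinset]
    exact ⟨hm _ (by simp), hm _ (by simp)⟩
  have hcount : ∀ p ∈ (pairs S).toFinset,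
      @List.count _ instBEqOfDecidableEq p (pairs S) ≤ s + 2 := by
    intro p hp
    by_contra hc
    have hne := h3 h.1 p (List.mem_toFinset.1 hp)
    apply h.2
    refine ⟨fun i => if i = 0 then p.1 else p.2, ?_, ?_⟩
    · intro x hx y hy hxy
      simp only [alternation, Set.mem_ofPred_eq, List.mem_map] at hx hy
      obtain ⟨i, -, rfl⟩ := hx
      obtain ⟨j, -, rfl⟩ := hy
      rcases Nat.mod_two_eq_zero_or_one i with hi | hi <;>
        rcases Nat.mod_two_eq_zero_or_one j with hj | hj <;> simp_all
    · have hrep : ∀ m, (List.replicate m p).flatMap (fun p => [p.1, p.2]) =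
          (alternation (2 * m)).map (fun i => if i = 0 then p.1 else p.2) := by
        intro m
        induction m with
        | zero => simp [alternation]
        | succ m ih =>
          rw [List.replicate_succ', List.flatMap_append, ih]
          simp [alternation, Nat.mul_add, List.range_succ, Nat.add_mod]
      have hsub : (List.replicate (s + 2) p).Sublist (pairs S) :=
        (@List.replicate_sublist_iff _ instBEqOfDecidableEq _ _ _ _).2 (not_le.1 hc).le
      have h4 := (hsub.flatMap (fun p => [p.1, p.2])).trans h1
      rw [hrep] at h4
      refine List.Sublist.trans ?_ h4
      refine List.Sublist.map _ (List.Sublist.map _ (List.range_sublist.2 (by omega)))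
  have hlen : (pairs S).length ≤ (S.toFinset.card * S.toFinset.card) * (s + 2) := by
    rw [← Finset.card_product, ← List.sum_toFinset_count_eq_length]
    refine (Finset.sum_le_card_nsmul _ _ _ hcount).trans ?_
    rw [smul_eq_mul]
    exact Nat.mul_le_mul_right _ (Finset.card_le_card fun p hp => hmem p (List.mem_toFinset.1 hp))
  omega

/-- For `s ≥ 1`, `λ_s(n)` is the maximum of the lengths, over a nonempty finite set of lengths. -/
theorem isGreatest_lambda (s n : ℕ) (hs : 1 ≤ s) : IsGreatest (dsLengths s n) (lambda s n) := by
  have hb : BddAbove (dsLengths s n) := by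
    refine ⟨2 * ((n * n) * (s + 2)) + 1, ?_⟩
    rintro L ⟨S, hS, rfl, rfl⟩
    exact length_le_of_isDS hS
  have hne : (dsLengths s n).Nonempty := by
    refine ⟨n, List.range n, ⟨?_, ?_⟩, ?_, by simp⟩
    · intro i j hij _ hj
      simp only [List.getElem_range]
      omega
    · rintro ⟨f, -, hf⟩
      have hnd := List.Nodup.of_map f (hf.nodup List.nodup_range)
      obtain ⟨t, rfl⟩ := Nat.exists_eq_add_of_le hs
      have h3 : (alternation 3).Sublist (alternation (1 + t + 2)) :=
        List.Sublist.map _ (List.range_sublist.2 (by omega))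
      have := h3.nodup hnd
      revert this
      decide
    · rw [List.toFinset_card_of_nodup List.nodup_range, List.length_range]
  exact ⟨Nat.sSup_mem hne hb, fun _ hL => le_csSup hb hL⟩

end DavenportSchinzel

/-! The limit is squeezed between 2(α(n) - 5) ≤ λ₃(n)/n and, for each fixed large l, λ₃(n)/n ≤ 2α(n)
+ 36α(n)/l + 3(1 + 2l).

Upper bound. Take a word without ababa cut into blocks of distinct letters, and group the blocks
into layers. Letters confined to one layer are handled layer by layer. For the others, the first
occurrences in each layer form a word whose blocks are the layers. The remaining occurrences number
at most two per letter (last occurrence in the letter's first or last layer) plus three per block.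
So coarsening costs 2 in the coefficient of the number of letters (`LayerBound.step`). Iterating
within one level of the hierarchy keeps the coefficient, and passing to the next level adds 2; hence
the coefficient 2k for up to A_k(t) blocks, with an error linear in the number of blocks for fixed k
and t (`layerBound_ackHierarchy`). A general word is cut into about 2n/l segments, each holding at
most l first or last occurrences of letters; deleting O(l²) repetitions per segment turns segments
into blocks (`card_repeated_le`).

Lower bound. The words built here contain marked blocks, in which each letter is recorded as
occurring for the first or for the last time. Replacing each block by a fresh copy of another such
word, and placing each letter of the block twice in that copy (inside one of its blocks and next to
it), adds two occurrences per letter and creates no ababa (`IsRich.expand`). After d rounds every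
letter occurs 2d + 3 times on average, and the number of blocks grows like level d + 2 of the
hierarchy (`mul_blockCount_le`). Deleting adjacent equal letters costs at most one occurrence per
letter, and superadditivity of λ₃ carries the bound to all large n. -/

namespace DavenportSchinzel

/-! ### Upper bound: words cut into blocks of distinct letters -/

/-- The word with letters `sym p`, for positions `p ∈ P`, has no alternation `a b a b a`. -/
def AltFree (sym : ℕ → ℕ) (P : Finset ℕ) : Prop :=
  ∀ p₁ ∈ P, ∀ p₂ ∈ P, ∀ p₃ ∈ P, ∀ p₄ ∈ P, ∀ p₅ ∈ P, p₁ < p₂ → p₂ < p₃ → p₃ < p₄ → p₄ < p₅ →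
    sym p₁ = sym p₃ → sym p₂ = sym p₄ → sym p₃ = sym p₅ → sym p₁ = sym p₂

theorem AltFree.mono {sym : ℕ → ℕ} {P Q : Finset ℕ} (h : AltFree sym P) (hQ : Q ⊆ P) :
    AltFree sym Q :=
  fun p₁ h₁ p₂ h₂ p₃ h₃ p₄ h₄ p₅ h₅ =>
    h p₁ (hQ h₁) p₂ (hQ h₂) p₃ (hQ h₃) p₄ (hQ h₄) p₅ (hQ h₅)

/-- Every word without `a b a b a` that is cut into blocks of distinct letters, the block numbers
running through an aligned interval of length `2 ^ e`, has length at most `c n + D`, where `n` is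
the number of its letters. -/
def LayerBound (e c D : ℕ) : Prop :=
  ∀ (sym blk : ℕ → ℕ) (P : Finset ℕ) (s : ℕ), Monotone blk → (∀ p ∈ P, blk p / 2 ^ e = s) →
    (∀ p ∈ P, ∀ p' ∈ P, blk p = blk p' → sym p = sym p' → p = p') → AltFree sym P →
    P.card ≤ c * (P.image sym).card + D

theorem LayerBound.mono {e c D c' D' : ℕ} (h : LayerBound e c D) (hc : c ≤ c') (hD : D ≤ D') :
    LayerBound e c' D' := fun sym blk P s h1 h2 h3 h4 =>
  (h sym blk P s h1 h2 h3 h4).trans (Nat.add_le_add (Nat.mul_le_mul_right _ hc) hD)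

theorem card_le_of_injOn_div {blk : ℕ → ℕ} {T : Finset ℕ} {q s : ℕ} (hq : 0 < q)
    (hs : ∀ p ∈ T, blk p / q = s)
    (hT : ∀ p ∈ T, ∀ p' ∈ T, p < p' → blk p = blk p' → False) : T.card ≤ q := by
  have : T.card ≤ (Finset.Ico (s * q) (s * q + q)).card := by
    refine Finset.card_le_card_of_injOn blk (fun p hp => ?_) (fun p hp p' hp' h => ?_)
    · have h1 := Nat.div_add_mod (blk p) q
      have h2 := Nat.mod_lt (blk p) hq
      rw [hs p hp, mul_comm] at h1
      simp only [Finset.coe_Ico, Set.mem_Ico]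
      omega
    · rcases lt_trichotomy p p' with h' | h' | h'
      · exact (hT p hp p' hp' h' h).elim
      · exact h'
      · exact (hT p' hp' p hp h' h.symm).elim
  simpa using this

theorem layerBound_zero : LayerBound 0 1 0 := by
  intro sym blk P s _ hs hinj _
  rw [one_mul, add_zero]
  refine (Finset.card_image_of_injOn fun p hp p' hp' h => hinj p hp p' hp' ?_ h).ge
  have h1 := hs p hp
  have h2 := hs p' hp'
  simp only [pow_zero, Nat.div_one] at h1 h2
  rw [h1, h2]

theorem layerBound_one : LayerBound 1 2 0 := by
  intro sym blk P s _ hs hinj _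
  have h : P.card ≤ ((P.image sym) ×ˢ Finset.range 2).card := by
    refine Finset.card_le_card_of_injOn (fun p => (sym p, blk p % 2)) (fun p hp => ?_)
      (fun p hp p' hp' h => ?_)
    · have := Nat.mod_lt (blk p) two_pos
      simp only [Finset.coe_product, Set.mem_prod, Finset.mem_coe, Finset.mem_range]
      exact ⟨Finset.mem_image_of_mem _ hp, this⟩
    · simp only [Prod.mk.injEq] at h
      refine hinj p hp p' hp' ?_ h.1
      have h1 := hs p hp
      have h2 := hs p' hp'
      omega
  rw [Finset.card_product, Finset.card_range] at h
  omega

/-- The letters that occur in two layers are counted by their first occurrences in each layer, up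
to two occurrences for each letter and three for each block. -/
theorem card_global_le {sym blk : ℕ → ℕ} {P : Finset ℕ} {e₁ e₂ s : ℕ} (hmono : Monotone blk)
    (hs : ∀ p ∈ P, blk p / 2 ^ (e₁ + e₂) = s)
    (hinj : ∀ p ∈ P, ∀ p' ∈ P, blk p = blk p' → sym p = sym p' → p = p') (hfree : AltFree sym P)
    (hglob : ∀ p ∈ P, ∃ p' ∈ P, sym p' = sym p ∧ blk p' / 2 ^ e₁ ≠ blk p / 2 ^ e₁)
    {c D : ℕ} (h₂ : LayerBound e₂ c D) :
    P.card ≤ (c + 2) * (P.image sym).card + D + 3 * 2 ^ (e₁ + e₂) := by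
  classical
  set lay : ℕ → ℕ := fun p => blk p / 2 ^ e₁ with hlay
  have hlm : Monotone lay := fun p p' h => Nat.div_le_div_right (hmono h)
  let isFirst : ℕ → Prop := fun p => ∀ p' ∈ P, sym p' = sym p → lay p' = lay p → p ≤ p'
  let isLast : ℕ → Prop := fun p => ∀ p' ∈ P, sym p' = sym p → lay p' = lay p → p' ≤ p
  let before : ℕ → Prop := fun p => ∃ p' ∈ P, sym p' = sym p ∧ lay p' < lay p
  let after : ℕ → Prop := fun p => ∃ p' ∈ P, sym p' = sym p ∧ lay p < lay p'
  -- A block holds each letter at most once, so an earlier occurrence in the layer lies in an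
  -- earlier block, hence before every position `r` of the block of `p`. `hnext` is the mirror
  -- image.
  have hprev : ∀ p ∈ P, ¬ isFirst p → ∀ r, blk r = blk p →
      ∃ p' ∈ P, sym p' = sym p ∧ lay p' = lay p ∧ p' < r := by
    intro p hp h r hr
    simp only [isFirst, not_forall, not_le] at h
    obtain ⟨p', hp', h1, h2, h3⟩ := h
    refine ⟨p', hp', h1, h2, hmono.reflect_lt ?_⟩
    rw [hr]
    refine lt_of_le_of_ne (hmono h3.le) fun h4 => h3.ne (hinj p' hp' p hp h4 h1)
  have hnext : ∀ p ∈ P, ¬ isLast p → ∀ r, blk r = blk p →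
      ∃ p' ∈ P, sym p' = sym p ∧ lay p' = lay p ∧ r < p' := by
    intro p hp h r hr
    simp only [isLast, not_forall, not_le] at h
    obtain ⟨p', hp', h1, h2, h3⟩ := h
    refine ⟨p', hp', h1, h2, hmono.reflect_lt ?_⟩
    rw [hr]
    refine lt_of_le_of_ne (hmono h3.le) fun h4 => h3.ne (hinj p hp p' hp' h4 h1.symm)
  have hq : 0 < 2 ^ (e₁ + e₂) := by positivity
  -- Keeping one occurrence per letter and layer makes the layers themselves blocks of distinct
  -- letters.
  have hF : (P.filter isFirst).card ≤ c * (P.image sym).card + D := by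
    refine (h₂ sym lay (P.filter isFirst) s hlm ?_ ?_
      (hfree.mono (Finset.filter_subset _ _))).trans ?_
    · intro p hp
      rw [hlay, Nat.div_div_eq_div_mul, ← pow_add]
      exact hs p (Finset.mem_filter.1 hp).1
    · intro p hp p' hp' h1 h2
      rw [Finset.mem_filter] at hp hp'
      exact le_antisymm (hp.2 p' hp'.1 h2.symm h1.symm) (hp'.2 p hp.1 h2 h1)
    · gcongr
      exact Finset.filter_subset _ _
  have hSL : (P.filter fun p => ¬ before p ∧ isLast p).card ≤ (P.image sym).card := by
    refine Finset.card_le_card_of_injOn sym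
      (fun p hp => Finset.mem_coe.2 (Finset.mem_image_of_mem _ (Finset.mem_filter.1 hp).1)) ?_
    intro p hp p' hp' h
    simp only [Finset.coe_filter, Set.mem_ofPred_eq] at hp hp'
    obtain ⟨hp, hb, hl⟩ := hp
    obtain ⟨hp', hb', hl'⟩ := hp'
    rcases lt_trichotomy (lay p) (lay p') with h' | h' | h'
    · exact (hb' ⟨p, hp, h, h'⟩).elim
    · exact le_antisymm (hl' p hp h h') (hl p' hp' h.symm h'.symm)
    · exact (hb ⟨p', hp', h.symm, h'⟩).elim
  have hEL : (P.filter fun p => ¬ after p ∧ isLast p).card ≤ (P.image sym).card := by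
    refine Finset.card_le_card_of_injOn sym
      (fun p hp => Finset.mem_coe.2 (Finset.mem_image_of_mem _ (Finset.mem_filter.1 hp).1)) ?_
    intro p hp p' hp' h
    simp only [Finset.coe_filter, Set.mem_ofPred_eq] at hp hp'
    obtain ⟨hp, hb, hl⟩ := hp
    obtain ⟨hp', hb', hl'⟩ := hp'
    rcases lt_trichotomy (lay p) (lay p') with h' | h' | h'
    · exact (hb ⟨p', hp', h.symm, h'⟩).elim
    · exact le_antisymm (hl' p hp h h') (hl p' hp' h.symm h'.symm)
    · exact (hb' ⟨p, hp, h, h'⟩).elim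
  -- Two such positions in one block, with letters a then b, give b a b a b: a `b` before and an `a`
  -- after them in the same layer, and another `b` in a later layer. `hE` is symmetric.
  have hS : (P.filter fun p => ¬ isFirst p ∧ ¬ isLast p ∧ after p).card ≤ 2 ^ (e₁ + e₂) := by
    refine card_le_of_injOn_div hq (fun p hp => hs p (Finset.mem_filter.1 hp).1) ?_
    intro p hp p' hp' hlt hb
    rw [Finset.mem_filter] at hp hp'
    have hll : lay p = lay p' := by simp only [hlay, hb]
    obtain ⟨x, hx, hx1, hx2, hx3⟩ := hprev p' hp'.1 hp'.2.1 p hb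
    obtain ⟨y, hy, hy1, hy2, hy3⟩ := hnext p hp.1 hp.2.2.1 p' hb.symm
    obtain ⟨z, hz, hz1, hz2⟩ := hp'.2.2.2
    have hyz : y < z := hlm.reflect_lt (by omega)
    have := hfree x hx p hp.1 p' hp'.1 y hy z hz hx3 hlt hy3 hyz hx1 hy1.symm hz1.symm
    exact hlt.ne (hinj p hp.1 p' hp'.1 hb (by omega))
  have hE : (P.filter fun p => ¬ isFirst p ∧ ¬ isLast p ∧ before p).card ≤ 2 ^ (e₁ + e₂) := by
    refine card_le_of_injOn_div hq (fun p hp => hs p (Finset.mem_filter.1 hp).1) ?_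
    intro p hp p' hp' hlt hb
    rw [Finset.mem_filter] at hp hp'
    have hll : lay p = lay p' := by simp only [hlay, hb]
    obtain ⟨x, hx, hx1, hx2, hx3⟩ := hprev p' hp'.1 hp'.2.1 p hb
    obtain ⟨y, hy, hy1, hy2, hy3⟩ := hnext p hp.1 hp.2.2.1 p' hb.symm
    obtain ⟨z, hz, hz1, hz2⟩ := hp.2.2.2
    have hzx : z < x := hlm.reflect_lt (by omega)
    have := hfree z hz x hx p hp.1 p' hp'.1 y hy hzx hx3 hlt hy3 hz1 hx1 hy1.symm
    exact hlt.ne (hinj p hp.1 p' hp'.1 hb (by omega))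
  -- Here the outer letters come from other layers: a (earlier layer), b (same layer), a, b, a
  -- (later layer).
  have hM : (P.filter fun p => ¬ isFirst p ∧ before p ∧ after p).card ≤ 2 ^ (e₁ + e₂) := by
    refine card_le_of_injOn_div hq (fun p hp => hs p (Finset.mem_filter.1 hp).1) ?_
    intro p hp p' hp' hlt hb
    rw [Finset.mem_filter] at hp hp'
    have hll : lay p = lay p' := by simp only [hlay, hb]
    obtain ⟨x, hx, hx1, hx2, hx3⟩ := hprev p' hp'.1 hp'.2.1 p hb
    obtain ⟨z, hz, hz1, hz2⟩ := hp.2.2.1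
    obtain ⟨y, hy, hy1, hy2⟩ := hp.2.2.2
    have hzx : z < x := hlm.reflect_lt (by omega)
    have hy3 : p' < y := hlm.reflect_lt (by omega)
    have := hfree z hz x hx p hp.1 p' hp'.1 y hy hzx hx3 hlt hy3 hz1 hx1 hy1.symm
    exact hlt.ne (hinj p hp.1 p' hp'.1 hb (by omega))
  have hcover : P ⊆ P.filter isFirst ∪ ((P.filter fun p => ¬ before p ∧ isLast p) ∪
      ((P.filter fun p => ¬ after p ∧ isLast p) ∪
      ((P.filter fun p => ¬ isFirst p ∧ ¬ isLast p ∧ after p) ∪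
      ((P.filter fun p => ¬ isFirst p ∧ ¬ isLast p ∧ before p) ∪
      (P.filter fun p => ¬ isFirst p ∧ before p ∧ after p))))) := by
    intro p hp
    have : before p ∨ after p := by
      obtain ⟨p', hp', h1, h2⟩ := hglob p hp
      rcases lt_or_gt_of_ne h2 with h | h
      · exact Or.inl ⟨p', hp', h1, h⟩
      · exact Or.inr ⟨p', hp', h1, h⟩
    have key : ∀ F L B A : Prop, B ∨ A → F ∨ (¬ B ∧ L) ∨ (¬ A ∧ L) ∨ (¬ F ∧ ¬ L ∧ A) ∨
        (¬ F ∧ ¬ L ∧ B) ∨ (¬ F ∧ B ∧ A) := by tauto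
    simp only [Finset.mem_union, Finset.mem_filter, hp, true_and]
    exact key (isFirst p) (isLast p) (before p) (after p) this
  have h := Finset.card_le_card hcover
  have u1 := Finset.card_union_le (P.filter isFirst) ((P.filter fun p => ¬ before p ∧ isLast p) ∪
      ((P.filter fun p => ¬ after p ∧ isLast p) ∪
      ((P.filter fun p => ¬ isFirst p ∧ ¬ isLast p ∧ after p) ∪
      ((P.filter fun p => ¬ isFirst p ∧ ¬ isLast p ∧ before p) ∪
      (P.filter fun p => ¬ isFirst p ∧ before p ∧ after p)))))
  have u2 := Finset.card_union_le (P.filter fun p => ¬ before p ∧ isLast p)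
      ((P.filter fun p => ¬ after p ∧ isLast p) ∪
      ((P.filter fun p => ¬ isFirst p ∧ ¬ isLast p ∧ after p) ∪
      ((P.filter fun p => ¬ isFirst p ∧ ¬ isLast p ∧ before p) ∪
      (P.filter fun p => ¬ isFirst p ∧ before p ∧ after p))))
  have u3 := Finset.card_union_le (P.filter fun p => ¬ after p ∧ isLast p)
      ((P.filter fun p => ¬ isFirst p ∧ ¬ isLast p ∧ after p) ∪
      ((P.filter fun p => ¬ isFirst p ∧ ¬ isLast p ∧ before p) ∪
      (P.filter fun p => ¬ isFirst p ∧ before p ∧ after p)))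
  have u4 := Finset.card_union_le (P.filter fun p => ¬ isFirst p ∧ ¬ isLast p ∧ after p)
      ((P.filter fun p => ¬ isFirst p ∧ ¬ isLast p ∧ before p) ∪
      (P.filter fun p => ¬ isFirst p ∧ before p ∧ after p))
  have u5 := Finset.card_union_le (P.filter fun p => ¬ isFirst p ∧ ¬ isLast p ∧ before p)
      (P.filter fun p => ¬ isFirst p ∧ before p ∧ after p)
  rw [add_mul]
  omega

/-- Letters meeting two layers are global and fall under `card_global_le`; a local letter belongs to
a single layer, so the bounds `h₁` of the 2^e₂ layers add up without counting a letter twice. -/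
theorem LayerBound.step {e₁ e₂ c D₁ D₂ : ℕ} (h₁ : LayerBound e₁ (c + 2) D₁)
    (h₂ : LayerBound e₂ c D₂) :
    LayerBound (e₁ + e₂) (c + 2) (2 ^ e₂ * D₁ + D₂ + 3 * 2 ^ (e₁ + e₂)) := by
  classical
  intro sym blk P s hmono hs hinj hfree
  set lay : ℕ → ℕ := fun p => blk p / 2 ^ e₁ with hlay
  let glob : ℕ → Prop := fun p => ∃ p' ∈ P, sym p' = sym p ∧ lay p' ≠ lay p
  have hgs : ∀ p ∈ P, ∀ p' ∈ P, sym p = sym p' → glob p → glob p' := by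
    rintro p hp p' hp' h ⟨r, hr, h1, h2⟩
    by_cases h3 : lay r = lay p'
    · exact ⟨p, hp, h, fun h4 => h2 (h3.trans h4.symm)⟩
    · exact ⟨r, hr, h1.trans h, h3⟩
  set G := P.filter glob with hG
  set L := P.filter (fun p => ¬ glob p) with hL
  have hGP : G ⊆ P := Finset.filter_subset _ _
  have hLP : L ⊆ P := Finset.filter_subset _ _
  have hGcard : G.card ≤ (c + 2) * (G.image sym).card + D₂ + 3 * 2 ^ (e₁ + e₂) := by
    refine card_global_le hmono (fun p hp => hs p (hGP hp))
      (fun p hp p' hp' => hinj p (hGP hp) p' (hGP hp')) (hfree.mono hGP) ?_ h₂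
    intro p hp
    have hp1 := Finset.mem_filter.1 hp
    obtain ⟨p', hp', h1, h2⟩ := hp1.2
    exact ⟨p', Finset.mem_filter.2 ⟨hp', hgs p hp1.1 p' hp' h1.symm hp1.2⟩, h1, h2⟩
  have hLcard : L.card ≤ (c + 2) * (L.image sym).card + 2 ^ e₂ * D₁ := by
    set I := Finset.Ico (s * 2 ^ e₂) (s * 2 ^ e₂ + 2 ^ e₂) with hI
    have hmaps : ∀ p ∈ L, lay p ∈ I := by
      intro p hp
      have h := hs p (hLP hp)
      rw [pow_add, ← Nat.div_div_eq_div_mul] at h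
      have h1 := Nat.div_add_mod (lay p) (2 ^ e₂)
      have h2 := Nat.mod_lt (lay p) (show 0 < 2 ^ e₂ by positivity)
      simp only [hlay] at h1 h2 ⊢
      rw [h, mul_comm] at h1
      rw [hI, Finset.mem_Ico]
      omega
    have hfib : ∀ i ∈ I, (L.filter fun p => lay p = i).card ≤
        (c + 2) * ((L.filter fun p => lay p = i).image sym).card + D₁ := by
      intro i _
      have hsub : (L.filter fun p => lay p = i) ⊆ P := (Finset.filter_subset _ _).trans hLP
      exact h₁ sym blk _ i hmono (fun p hp => (Finset.mem_filter.1 hp).2)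
        (fun p hp p' hp' => hinj p (hsub hp) p' (hsub hp')) (hfree.mono hsub)
    have hdisj : ∑ i ∈ I, ((L.filter fun p => lay p = i).image sym).card ≤
        (L.image sym).card := by
      rw [← Finset.card_biUnion]
      · refine Finset.card_le_card ?_
        intro a ha
        rw [Finset.mem_biUnion] at ha
        obtain ⟨i, _, ha⟩ := ha
        exact Finset.image_subset_image (Finset.filter_subset _ _) ha
      · intro i _ j _ hij
        simp only [Function.onFun]
        rw [Finset.disjoint_left]
        intro a ha hb
        simp only [Finset.mem_image, Finset.mem_filter] at ha hb
        obtain ⟨p, ⟨hp, rfl⟩, rfl⟩ := ha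
        obtain ⟨p', ⟨hp', rfl⟩, h⟩ := hb
        exact (Finset.mem_filter.1 hp).2 ⟨p', hLP hp', h, fun h' => hij h'.symm⟩
    rw [Finset.card_eq_sum_card_fiberwise hmaps]
    refine (Finset.sum_le_sum hfib).trans ?_
    rw [Finset.sum_add_distrib, ← Finset.mul_sum, Finset.sum_const, hI, Nat.card_Ico,
      smul_eq_mul]
    rw [hI] at hdisj
    simp only [Nat.add_sub_cancel_left]
    gcongr
  have himg : (G.image sym).card + (L.image sym).card ≤ (P.image sym).card := by
    rw [← Finset.card_union_of_disjoint]
    · refine Finset.card_le_card (Finset.union_subset ?_ ?_)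
      · exact Finset.image_subset_image hGP
      · exact Finset.image_subset_image hLP
    · rw [Finset.disjoint_left]
      intro a ha hb
      simp only [Finset.mem_image] at ha hb
      obtain ⟨p, hp, rfl⟩ := ha
      obtain ⟨p', hp', h⟩ := hb
      exact (Finset.mem_filter.1 hp').2
        (hgs p (hGP hp) p' (hLP hp') h.symm (Finset.mem_filter.1 hp).2)
  have hsum : G.card + L.card = P.card := by
    rw [hG, hL, Finset.card_filter_add_card_filter_not]
  have := Nat.mul_le_mul_left (c + 2) himg
  rw [mul_add] at this
  omega

/-! ### Upper bound: iteration along the Ackermann hierarchy -/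

theorem ackHierarchy_succ_succ (k n : ℕ) :
    ackHierarchy (k + 2) (n + 1) = ackHierarchy (k + 1) (ackHierarchy (k + 2) n) := by
  simp only [ackHierarchy, Function.iterate_succ_apply']

theorem ackHierarchy_two (n : ℕ) : ackHierarchy 2 n = 2 ^ n := by
  induction n with
  | zero => simp [ackHierarchy]
  | succ n ih => rw [ackHierarchy_succ_succ, ih, pow_succ']; simp [ackHierarchy]

theorem ackHierarchy_eq_two_pow (k n : ℕ) : ∃ e, ackHierarchy (k + 2) n = 2 ^ e := by
  induction k generalizing n with
  | zero => exact ⟨n, ackHierarchy_two n⟩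
  | succ k ih =>
    cases n with
    | zero => exact ⟨0, by simp [ackHierarchy]⟩
    | succ n => rw [ackHierarchy_succ_succ]; exact ih _

/-- Repeated doubling: two layers at a time, where first occurrences per layer cost coefficient 2.
-/
theorem layerBound_four (e : ℕ) : LayerBound e 4 (3 * e * 2 ^ e) := by
  induction e with
  | zero => exact layerBound_zero.mono (by norm_num) (by norm_num)
  | succ e ih =>
    refine (LayerBound.step ih layerBound_one).mono le_rfl (le_of_eq ?_)
    ring

/-- Follows A_{k+3}(t+1) = A_{k+2}(A_{k+3}(t)): layers of A_{k+3}(t) blocks, at most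
A_{k+2}(A_{k+3}(t)) layers. The values are powers of two, so layers are aligned dyadic intervals. -/
theorem layerBound_ackHierarchy (k t e : ℕ) (he : 2 ^ e ≤ ackHierarchy (k + 2) t) :
    LayerBound e (2 * (k + 2)) (3 * (k + 2) * t * 2 ^ e) := by
  induction k generalizing t e with
  | zero =>
    rw [ackHierarchy_two] at he
    have := (Nat.pow_le_pow_iff_right (by norm_num)).1 he
    refine (layerBound_four e).mono le_rfl ?_
    gcongr
    omega
  | succ k ih =>
    induction t generalizing e with
    | zero =>
      have h1 : ackHierarchy (k + 3) 0 = 2 ^ 0 := by simp [ackHierarchy]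
      rw [show k + 1 + 2 = k + 3 by ring, h1] at he
      obtain rfl : e = 0 := Nat.le_zero.1 ((Nat.pow_le_pow_iff_right (by norm_num)).1 he)
      exact layerBound_zero.mono (by omega) (by omega)
    | succ t iht =>
      obtain ⟨e₁, he₁⟩ := ackHierarchy_eq_two_pow (k + 1) t
      rcases le_total e e₁ with h | h
      · refine (iht e ?_).mono le_rfl ?_
        · rw [he₁]
          exact Nat.pow_le_pow_right (by norm_num) h
        · gcongr
          omega
      · obtain ⟨e₂, rfl⟩ := Nat.exists_eq_add_of_le h
        rw [ackHierarchy_succ_succ, he₁] at he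
        -- The parameter t of the lower level is the layer size 2^e₁, so its error 3(k+2)·2^e₁·2^e₂
        -- is a multiple of the total number of blocks; each increase of t thus costs 3(k+3) per
        -- block.
        have h2 := ih (2 ^ e₁) e₂ ((Nat.pow_le_pow_right (by norm_num) (by omega)).trans he)
        have h1 := iht e₁ he₁.ge
        rw [show 2 * (k + 1 + 2) = 2 * (k + 2) + 2 by ring] at h1 ⊢
        refine (LayerBound.step h1 h2).mono le_rfl ?_
        rw [pow_add]
        have : 3 * (k + 1 + 2) * (t + 1) * (2 ^ e₁ * 2 ^ e₂) =
          2 ^ e₂ * (3 * (k + 1 + 2) * t * 2 ^ e₁) + 3 * (k + 2) * 2 ^ e₁ * 2 ^ e₂ +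
            3 * (2 ^ e₁ * 2 ^ e₂) := by ring
        exact this.ge

theorem exists_lt_lt_of_two_lt_card {T : Finset ℕ} (h : 2 < T.card) :
    ∃ a ∈ T, ∃ b ∈ T, ∃ c ∈ T, a < b ∧ b < c := by
  obtain ⟨a, ha, b, hb, c, hc, hab, hac, hbc⟩ := Finset.two_lt_card.1 h
  rcases lt_or_gt_of_ne hab with h1 | h1 <;> rcases lt_or_gt_of_ne hac with h2 | h2 <;>
    rcases lt_or_gt_of_ne hbc with h3 | h3
  · exact ⟨a, ha, b, hb, c, hc, h1, h3⟩
  · exact ⟨a, ha, c, hc, b, hb, h2, h3⟩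
  · omega
  · exact ⟨c, hc, a, ha, b, hb, h2, h1⟩
  · exact ⟨b, hb, a, ha, c, hc, h1, h2⟩
  · omega
  · exact ⟨b, hb, c, hc, a, ha, h3, h2⟩
  · exact ⟨c, hc, b, hb, a, ha, h3, h1⟩

/-! ### Upper bound: cutting a Davenport–Schinzel word into blocks -/

section Segments

variable (sym : ℕ → ℕ) (L : ℕ)

open Classical in
/-- The positions below `L` at which a letter occurs for the first or for the last time. -/
noncomputable def extremal : Finset ℕ :=
  (Finset.range L).filter fun q =>
    (∀ r < q, sym r ≠ sym q) ∨ ∀ r, q < r → r < L → sym r ≠ sym q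

theorem card_extremal_le :
    (extremal sym L).card ≤ 2 * ((Finset.range L).image sym).card := by
  classical
  have h1 : ((Finset.range L).filter fun q => ∀ r < q, sym r ≠ sym q).card ≤
      ((Finset.range L).image sym).card := by
    refine Finset.card_le_card_of_injOn sym
      (fun p hp => Finset.mem_coe.2 (Finset.mem_image_of_mem _ (Finset.mem_filter.1 hp).1)) ?_
    intro p hp p' hp' h
    simp only [Finset.coe_filter, Set.mem_ofPred_eq] at hp hp'
    rcases lt_trichotomy p p' with h' | h' | h'
    · exact (hp'.2 p h' h).elim
    · exact h'
    · exact (hp.2 p' h' h.symm).elim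
  have h2 : ((Finset.range L).filter fun q => ∀ r, q < r → r < L → sym r ≠ sym q).card ≤
      ((Finset.range L).image sym).card := by
    refine Finset.card_le_card_of_injOn sym
      (fun p hp => Finset.mem_coe.2 (Finset.mem_image_of_mem _ (Finset.mem_filter.1 hp).1)) ?_
    intro p hp p' hp' h
    simp only [Finset.coe_filter, Set.mem_ofPred_eq, Finset.mem_range] at hp hp'
    rcases lt_trichotomy p p' with h' | h' | h'
    · exact (hp.2 p' h' hp'.1 h.symm).elim
    · exact h'
    · exact (hp'.2 p h' hp.1 h).elim
  have h3 := Finset.card_union_le ((Finset.range L).filter fun q => ∀ r < q, sym r ≠ sym q)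
    ((Finset.range L).filter fun q => ∀ r, q < r → r < L → sym r ≠ sym q)
  rw [← Finset.filter_or] at h3
  unfold extremal
  omega

/-- The number of extremal positions before `p`. -/
noncomputable def extremalBefore (p : ℕ) : ℕ := ((extremal sym L).filter (· < p)).card

theorem extremalBefore_le (p : ℕ) :
    extremalBefore sym L p ≤ 2 * ((Finset.range L).image sym).card :=
  (Finset.card_filter_le _ _).trans (card_extremal_le sym L)

theorem extremalBefore_mono : Monotone (extremalBefore sym L) := fun p p' h =>
  Finset.card_le_card fun q hq => by
    rw [Finset.mem_filter] at hq ⊢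
    exact ⟨hq.1, hq.2.trans_le h⟩

theorem extremalBefore_lt {q p : ℕ} (hq : q ∈ extremal sym L) (h : q < p) :
    extremalBefore sym L q < extremalBefore sym L p := by
  refine Finset.card_lt_card ((Finset.ssubset_iff_of_subset ?_).2 ⟨q, ?_, ?_⟩)
  · intro r hr
    rw [Finset.mem_filter] at hr ⊢
    exact ⟨hr.1, hr.2.trans h⟩
  · exact Finset.mem_filter.2 ⟨hq, h⟩
  · simp

variable (l : ℕ)

/-- The letters that occur for the first or the last time in the `i`-th segment, where the word is
cut into segments that hold `l` extremal positions each. -/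
noncomputable def extremalLetters (i : ℕ) : Finset ℕ :=
  ((extremal sym L).filter fun q => extremalBefore sym L q / l = i).image sym

variable {l}

theorem card_extremalLetters_le (hl : 0 < l) (i : ℕ) : (extremalLetters sym L l i).card ≤ l := by
  refine Finset.card_image_le.trans (card_le_of_injOn_div (blk := extremalBefore sym L) hl
    (fun p hp => (Finset.mem_filter.1 hp).2) ?_)
  intro p hp p' _ hlt h
  exact (extremalBefore_lt sym L (Finset.mem_filter.1 hp).1 hlt).ne h

variable {sym L}

/-- The first and the last occurrence of the letter are extremal positions, so neither can lie in
the segment. -/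
theorem exists_before_after_of_notMem {p i : ℕ} (hp : p < L) (hi : extremalBefore sym L p / l = i)
    (h : sym p ∉ extremalLetters sym L l i) :
    (∃ u, sym u = sym p ∧ u < L ∧ extremalBefore sym L u / l < i) ∧
      ∃ v, sym v = sym p ∧ v < L ∧ i < extremalBefore sym L v / l := by
  classical
  have hne : ((Finset.range L).filter fun q => sym q = sym p).Nonempty :=
    ⟨p, by simpa using hp⟩
  set T := (Finset.range L).filter fun q => sym q = sym p
  have key : ∀ u ∈ T, u ∈ extremal sym L → extremalBefore sym L u / l ≠ i := by
    intro u hu hu' hui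
    refine h (Finset.mem_image.2 ⟨u, Finset.mem_filter.2 ⟨hu', hui⟩, (Finset.mem_filter.1 hu).2⟩)
  have hpT : p ∈ T := by simpa [T] using hp
  constructor
  · have hm := T.min'_mem hne
    have hm1 := Finset.mem_filter.1 hm
    refine ⟨T.min' hne, hm1.2, Finset.mem_range.1 hm1.1,
      lt_of_le_of_ne ?_ (key _ hm (Finset.mem_filter.2 ⟨hm1.1, Or.inl fun r hr h' => ?_⟩))⟩
    · rw [← hi]
      exact Nat.div_le_div_right (extremalBefore_mono sym L (T.min'_le p hpT))
    · refine absurd (T.min'_le r (Finset.mem_filter.2 ⟨?_, h'.trans hm1.2⟩)) (not_le.2 hr)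
      have := Finset.mem_range.1 hm1.1
      exact Finset.mem_range.2 (by omega)
  · have hm := T.max'_mem hne
    have hm1 := Finset.mem_filter.1 hm
    refine ⟨T.max' hne, hm1.2, Finset.mem_range.1 hm1.1,
      lt_of_le_of_ne ?_ (key _ hm (Finset.mem_filter.2
        ⟨hm1.1, Or.inr fun r hr hr' h' => ?_⟩)).symm⟩
    · rw [← hi]
      exact Nat.div_le_div_right (extremalBefore_mono sym L (T.le_max' p hpT))
    · exact absurd (T.le_max' r (Finset.mem_filter.2 ⟨Finset.mem_range.2 hr', h'.trans hm1.2⟩))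
        (not_le.2 hr)

/-- Otherwise the letter b in between also occurs before and after the segment, and b a b a b
appears. -/
theorem mem_extremalLetters_of_between (hfree : AltFree sym (Finset.range L)) {r q p i : ℕ}
    (hrq : r < q) (hqp : q < p) (hpL : p < L) (hr : extremalBefore sym L r / l = i)
    (hp : extremalBefore sym L p / l = i) (hrp : sym r = sym p) (hne : sym q ≠ sym p) :
    sym q ∈ extremalLetters sym L l i := by
  have hm : Monotone fun p => extremalBefore sym L p / l := fun a b h =>
    Nat.div_le_div_right (extremalBefore_mono sym L h)
  by_contra h
  have hq : extremalBefore sym L q / l = i :=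
    le_antisymm ((hm hqp.le).trans_eq hp) (hr.symm.trans_le (hm hrq.le))
  obtain ⟨⟨u, hu, huL, hui⟩, v, hv, hvL, hvi⟩ :=
    exists_before_after_of_notMem (hqp.trans hpL) hq h
  have h1 : u < r := hm.reflect_lt (by omega)
  have h2 : p < v := hm.reflect_lt (by omega)
  have := hfree u (by simpa) r (by simp; omega) q (by simp; omega) p (by simpa) v (by simpa)
    h1 hrq hqp h2 hu hrp hv.symm
  exact hne (by rw [← hu, this, hrp])

/-- In each segment only boundedly many positions repeat a letter of the segment. -/
theorem card_repeated_le (hl : 0 < l) (hadj : ∀ p, p + 1 < L → sym p ≠ sym (p + 1))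
    (hfree : AltFree sym (Finset.range L)) (i : ℕ) (R : Finset ℕ)
    (hR : ∀ p ∈ R, p < L ∧ extremalBefore sym L p / l = i ∧
      ∃ r < p, sym r = sym p ∧ extremalBefore sym L r / l = i) :
    R.card ≤ l + 2 * (l * l) := by
  classical
  set K := extremalLetters sym L l i with hK
  have hKc : K.card ≤ l := card_extremalLetters_le sym L hl i
  have hpos : ∀ p ∈ R, 0 < p := fun p hp => by
    obtain ⟨_, _, r, hr, _⟩ := hR p hp
    omega
  have hneq : ∀ p ∈ R, sym (p - 1) ≠ sym p := fun p hp => by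
    have h1 := hadj (p - 1) (by have := hR p hp; have := hpos p hp; omega)
    rwa [Nat.sub_add_cancel (hpos p hp)] at h1
  -- The predecessor of a repeated position lies strictly between two equal letters and differs from
  -- them, so it carries a letter of `K`.
  have hpred : ∀ p ∈ R, sym (p - 1) ∈ K ∧ extremalBefore sym L (p - 1) / l = i := by
    intro p hp
    obtain ⟨hpL, hpi, r, hr, hrp, hri⟩ := hR p hp
    have hr' : r < p - 1 := by
      rcases (Nat.le_sub_one_of_lt hr).lt_or_eq with h | h
      · exact h
      · exact (hneq p hp (by rw [← h, hrp])).elim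
    have hp1 : p - 1 < p := Nat.sub_lt (hpos p hp) one_pos
    refine ⟨mem_extremalLetters_of_between hfree hr' hp1 hpL hri hpi hrp (hneq p hp),
      le_antisymm ?_ ?_⟩
    · rw [← hpi]
      exact Nat.div_le_div_right (extremalBefore_mono sym L hp1.le)
    · rw [← hri]
      exact Nat.div_le_div_right (extremalBefore_mono sym L hr'.le)
  -- Two predecessors with the same letter would enclose the first of the two positions and force
  -- its letter into `K`; so the predecessors carry distinct letters of `K`.
  have h1 : (R.filter fun p => sym p ∉ K).card ≤ K.card := by
    have haux : ∀ p ∈ R, sym p ∉ K → ∀ p' ∈ R, sym (p - 1) = sym (p' - 1) → p < p' → False := by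
      intro p hp hpK p' hp' h hlt
      have h1 : p ≠ p' - 1 := fun h' => hpK (h' ▸ (hpred p' hp').1)
      have h0 := hpos p hp
      have := hR p' hp'
      exact hpK (mem_extremalLetters_of_between hfree (r := p - 1) (p := p' - 1) (by omega)
        (by omega) (by omega) (hpred p hp).2 (hpred p' hp').2 h
        fun h' => hpK (h' ▸ (hpred p' hp').1))
    refine Finset.card_le_card_of_injOn (fun p => sym (p - 1))
      (fun p hp => (hpred p (Finset.mem_filter.1 hp).1).1) ?_
    intro p hp p' hp' h
    simp only [Finset.coe_filter, Set.mem_ofPred_eq] at hp hp'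
    rcases lt_trichotomy p p' with h' | h' | h'
    · exact (haux p hp.1 hp.2 p' hp'.1 h h').elim
    · exact h'
    · exact (haux p' hp'.1 hp'.2 p hp.1 h.symm h').elim
  have h2 : (R.filter fun p => sym p ∈ K).card ≤ 2 * (K ×ˢ K).card := by
    refine Finset.card_le_mul_card_image_of_maps_to (f := fun p => (sym (p - 1), sym p))
      (fun p hp => ?_) 2 fun b _ => ?_
    · rw [Finset.mem_filter] at hp
      exact Finset.mem_product.2 ⟨(hpred p hp.1).1, hp.2⟩
    · by_contra hc
      obtain ⟨x, hx, y, hy, z, hz, hxy, hyz⟩ := exists_lt_lt_of_two_lt_card (not_le.1 hc)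
      simp only [Finset.mem_filter] at hx hy hz
      obtain ⟨⟨hx, -⟩, hxb⟩ := hx
      obtain ⟨⟨hy, -⟩, hyb⟩ := hy
      obtain ⟨⟨hz, -⟩, hzb⟩ := hz
      have e1 := hxb.trans hyb.symm
      have e2 := hyb.trans hzb.symm
      simp only [Prod.mk.injEq] at e1 e2
      have hx0 := hpos x hx
      have hxy' : x ≠ y - 1 := fun h => hneq y hy (by rw [← h, e1.2])
      have hyz' : y ≠ z - 1 := fun h => hneq z hz (by rw [← h, e2.2])
      have hzL := (hR z hz).1
      -- Three occurrences of the same adjacent pair contain a b a b a.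
      refine hneq x hx (hfree (x - 1) ?_ x ?_ (y - 1) ?_ y ?_ (z - 1) ?_ ?_ ?_ ?_ ?_
        e1.1 e1.2 e2.1) <;> (try rw [Finset.mem_range]) <;> omega
  have h3 := Finset.card_filter_add_card_filter_not (s := R) (fun p => sym p ∈ K)
  rw [Finset.card_product] at h2
  have h4 := Nat.mul_le_mul hKc hKc
  omega

/-- Keeping the first occurrence of each letter in each segment leaves blocks of distinct letters,
to which `hb` applies; `card_repeated_le` counts what is deleted. -/
theorem length_le_of_layerBound (hl : 0 < l) (hadj : ∀ p, p + 1 < L → sym p ≠ sym (p + 1))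
    (hfree : AltFree sym (Finset.range L)) {e c D : ℕ} (hb : LayerBound e c D)
    (he : 2 * ((Finset.range L).image sym).card / l < 2 ^ e) :
    L ≤ c * ((Finset.range L).image sym).card + D +
      (2 * ((Finset.range L).image sym).card / l + 1) * (l + 2 * (l * l)) := by
  classical
  set n := ((Finset.range L).image sym).card with hn
  set seg : ℕ → ℕ := fun p => extremalBefore sym L p / l with hseg
  have hm : Monotone seg := fun a b h => Nat.div_le_div_right (extremalBefore_mono sym L h)
  have hsegle : ∀ p, seg p ≤ 2 * n / l := fun p => Nat.div_le_div_right
    (extremalBefore_le sym L p)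
  let first : ℕ → Prop := fun p => ∀ r < p, sym r = sym p → seg r ≠ seg p
  have hF : ((Finset.range L).filter first).card ≤ c * n + D := by
    refine (hb sym seg _ 0 hm (fun p _ => ?_) ?_
      (hfree.mono (Finset.filter_subset _ _))).trans ?_
    · exact Nat.div_eq_of_lt ((hsegle p).trans_lt he)
    · intro p hp p' hp' h h'
      rw [Finset.mem_filter] at hp hp'
      rcases lt_trichotomy p p' with h'' | h'' | h''
      · exact (hp'.2 p h'' h' h).elim
      · exact h''
      · exact (hp.2 p' h'' h'.symm h.symm).elim
    · exact Nat.add_le_add_right (Nat.mul_le_mul_left _ (Finset.card_le_card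
        (Finset.image_subset_image (Finset.filter_subset _ _)))) _
  have hR : ((Finset.range L).filter fun p => ¬ first p).card ≤
      (2 * n / l + 1) * (l + 2 * (l * l)) := by
    rw [Finset.card_eq_sum_card_fiberwise (f := seg) (t := Finset.range (2 * n / l + 1))
      (fun p _ => Finset.mem_coe.2 (Finset.mem_range.2 (Nat.lt_succ_of_le (hsegle p))))]
    refine (Finset.sum_le_card_nsmul _ _ (l + 2 * (l * l)) fun i _ => ?_).trans ?_
    · refine card_repeated_le hl hadj hfree i _ fun p hp => ?_
      simp only [Finset.mem_filter, Finset.mem_range, first, not_forall, not_not] at hp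
      obtain ⟨⟨hpL, r, hr, hrp, hri⟩, hpi⟩ := hp
      exact ⟨hpL, hpi, r, hr, hrp, hri.trans hpi⟩
    · rw [Finset.card_range, smul_eq_mul]
  have h3 := Finset.card_filter_add_card_filter_not (s := Finset.range L) first
  rw [Finset.card_range] at h3
  omega

end Segments

/-! ### Upper bound: passing from positions to lists -/

theorem contains_alternation_five {S : List ℕ} :
    Contains (alternation 5) S ↔ ∃ x y, x ≠ y ∧ [x, y, x, y, x].Sublist S := by
  have h5 : alternation 5 = [0, 1, 0, 1, 0] := by decide
  rw [h5]
  constructor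
  · rintro ⟨f, hf, h⟩
    exact ⟨f 0, f 1, fun h01 => by simpa using hf (by simp) (by simp) h01, by simpa using h⟩
  · rintro ⟨x, y, hxy, h⟩
    refine ⟨fun i => if i = 0 then x else y, ?_, by simpa using h⟩
    intro a ha b hb hab
    simp only [List.mem_cons, List.not_mem_nil, or_false, Set.mem_ofPred_eq] at ha hb
    have ha' : a = 0 ∨ a = 1 := by tauto
    have hb' : b = 0 ∨ b = 1 := by tauto
    rcases ha' with rfl | rfl <;> rcases hb' with rfl | rfl <;> simp_all

theorem isSparse_two_iff {β : Type*} {S : List β} : IsSparse 2 S ↔ S.IsChain (· ≠ ·) := by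
  rw [List.isChain_iff_getElem]
  constructor
  · intro h i hi
    exact h i (i + 1) (by omega) (by omega) (by omega)
  · intro h i j hij hj hjl
    obtain rfl : j = i + 1 := by omega
    exact h i (by omega)

theorem isDS_three_iff {S : List ℕ} :
    IsDS 3 S ↔ S.IsChain (· ≠ ·) ∧ ∀ x y, x ≠ y → ¬ [x, y, x, y, x].Sublist S := by
  rw [IsDS, isSparse_two_iff, contains_alternation_five]
  push Not
  rfl

theorem altFree_getD {S : List ℕ} (h : ∀ x y, x ≠ y → ¬ [x, y, x, y, x].Sublist S) :
    AltFree (fun p => S.getD p 0) (Finset.range S.length) := by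
  intro p₁ h₁ p₂ h₂ p₃ h₃ p₄ h₄ p₅ h₅ h12 h23 h34 h45 e1 e2 e3
  rw [Finset.mem_range] at h₁ h₂ h₃ h₄ h₅
  by_contra hne
  refine h _ _ hne ?_
  have := List.map_getElem_sublist (l := S)
    (is := [⟨p₁, h₁⟩, ⟨p₂, h₂⟩, ⟨p₃, h₃⟩, ⟨p₄, h₄⟩, ⟨p₅, h₅⟩]) (by
      simp only [List.pairwise_cons, List.mem_cons, List.not_mem_nil, or_false, Fin.lt_def]
      refine ⟨?_, ?_, ?_, ?_, ?_, List.Pairwise.nil⟩ <;> (try rintro a (rfl | rfl | rfl | rfl)) <;>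
        simp <;> omega)
  simp only [List.getD_eq_getElem _ _ h₁, List.getD_eq_getElem _ _ h₂,
    List.getD_eq_getElem _ _ h₃, List.getD_eq_getElem _ _ h₄,
    List.getD_eq_getElem _ _ h₅] at e1 e2 e3 ⊢
  simpa [e1, e2, e3] using this

theorem image_getD_range (S : List ℕ) :
    (Finset.range S.length).image (fun p => S.getD p 0) = S.toFinset := by
  ext a
  simp only [Finset.mem_image, Finset.mem_range, List.mem_toFinset, List.mem_iff_getElem]
  constructor
  · rintro ⟨p, hp, rfl⟩
    exact ⟨p, hp, (List.getD_eq_getElem _ _ hp).symm⟩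
  · rintro ⟨p, hp, rfl⟩
    exact ⟨p, hp, List.getD_eq_getElem _ _ hp⟩

/-- The upper bound for `λ₃`, with a free parameter `l`. -/
theorem lambda_three_le {n l e k : ℕ} (hl : 0 < l) (he : 2 * n / l < 2 ^ e)
    (hk : 2 ^ e ≤ ackHierarchy (k + 2) 3) :
    lambda 3 n ≤ 2 * (k + 2) * n + 9 * (k + 2) * 2 ^ e + (2 * n / l + 1) * (l + 2 * (l * l)) := by
  obtain ⟨S, hS, hn, hlen⟩ := (isGreatest_lambda 3 n (by norm_num)).1
  rw [isDS_three_iff] at hS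
  have h := length_le_of_layerBound (sym := fun p => S.getD p 0) (L := S.length) hl ?_
    (altFree_getD hS.2) (layerBound_ackHierarchy k 3 e hk) ?_
  · rw [image_getD_range, hn, hlen] at h
    refine h.trans (le_of_eq ?_)
    ring
  · intro p hp
    rw [List.getD_eq_getElem _ _ hp, List.getD_eq_getElem _ _ (by omega)]
    exact List.isChain_iff_getElem.1 hS.1 p hp
  · rwa [image_getD_range, hn]

/-! ### Lower bound: adjacent repetitions and alternations in lists -/

section AdjacentRepeats

variable {γ : Type*}

open Classical in
/-- The number of adjacent equal pairs of entries that satisfy `p`. -/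
noncomputable def adjEq (p : γ → Prop) : List γ → ℕ
  | x :: y :: l => (if x = y ∧ p x then 1 else 0) + adjEq p (y :: l)
  | _ => 0

theorem adjEq_cons_le (p : γ → Prop) (x : γ) (l : List γ) : adjEq p (x :: l) ≤ adjEq p l + 1 := by
  cases l with
  | nil => simp [adjEq]
  | cons y l => simp only [adjEq]; split_ifs <;> omega

theorem adjEq_append_le (p : γ → Prop) (l₁ l₂ : List γ) :
    adjEq p (l₁ ++ l₂) ≤ adjEq p l₁ + adjEq p l₂ + 1 := by
  induction l₁ with
  | nil => simp [adjEq]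
  | cons x l ih =>
    cases l with
    | nil => simpa [adjEq] using adjEq_cons_le p x l₂
    | cons y l => simp only [List.cons_append, adjEq] at ih ⊢; omega

theorem adjEq_eq_zero_of_nodup (p : γ → Prop) {l : List γ} (h : l.Nodup) : adjEq p l = 0 := by
  induction l with
  | nil => simp [adjEq]
  | cons x l ih =>
    cases l with
    | nil => simp [adjEq]
    | cons y l =>
      have h1 := List.nodup_cons.1 h
      have : x ≠ y := fun h' => h1.1 (h' ▸ List.mem_cons_self)
      simp [adjEq, ih h1.2, this]

theorem exists_isChain_sublist (l : List γ) :
    ∃ l' : List γ, l'.Sublist l ∧ l'.IsChain (· ≠ ·) ∧ l.length ≤ l'.length + adjEq (fun _ => True) l := by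
  cases l with
  | nil => exact ⟨[], by simp⟩
  | cons x l =>
    suffices h : ∃ l' : List γ, (x :: l').Sublist (x :: l) ∧ (x :: l').IsChain (· ≠ ·) ∧
        l.length ≤ l'.length + adjEq (fun _ => True) (x :: l) by
      obtain ⟨l', h1, h2, h3⟩ := h
      exact ⟨x :: l', h1, h2, by simp only [List.length_cons]; omega⟩
    induction l generalizing x with
    | nil => exact ⟨[], by simp⟩
    | cons y l ih =>
      obtain ⟨l', h1, h2, h3⟩ := ih y
      by_cases hxy : x = y
      · subst hxy
        refine ⟨l', h1.cons _, h2, ?_⟩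
        simp only [adjEq, List.length_cons, and_self, if_true]
        omega
      · refine ⟨y :: l', h1.cons_cons _, List.isChain_cons_cons.2 ⟨hxy, h2⟩, ?_⟩
        simp only [adjEq, List.length_cons]
        omega

end AdjacentRepeats

theorem sublist_of_sublist_append {γ : Type*} {x y : γ} {l P W : List γ}
    (h : (x :: y :: l).Sublist (P ++ W)) (hP : ¬ [x, y].Sublist P) : (y :: l).Sublist W := by
  obtain ⟨u, v, huv, hu, hv⟩ := List.sublist_append_iff.1 h
  match u, huv, hu with
  | [], huv, _ =>
    simp only [List.nil_append] at huv
    exact (List.sublist_cons_self x _).trans (huv ▸ hv)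
  | [_], huv, _ =>
    simp only [List.cons_append, List.nil_append, List.cons.injEq] at huv
    exact huv.2 ▸ hv
  | a :: b :: u, huv, hu =>
    simp only [List.cons_append, List.cons.injEq] at huv
    obtain ⟨rfl, rfl, -⟩ := huv
    exact (hP ((List.Sublist.cons_cons _ (List.Sublist.cons_cons _ (List.nil_sublist _))).trans
      hu)).elim

/-- An alternation loses at most one letter in a segment that misses one of its two letters. -/
theorem sublist_of_sublist_append_of_notMem {γ : Type*} {x y : γ} {l P W : List γ}
    (h : (x :: y :: l).Sublist (P ++ W)) (hP : x ∉ P ∨ y ∉ P) : (y :: l).Sublist W :=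
  sublist_of_sublist_append h fun hs =>
    hP.elim (fun h => h (hs.subset (by simp))) fun h => h (hs.subset (by simp))

/-- Each segment absorbs at most one letter of the alternation, and there are five letters for four
segments. -/
theorem not_sublist_of_four_segments {γ : Type*} {x y : γ} {P Q R S : List γ}
    (hP : x ∉ P ∨ y ∉ P) (hQ : x ∉ Q ∨ y ∉ Q) (hR : x ∉ R ∨ y ∉ R) (hS : x ∉ S ∨ y ∉ S) :
    ¬ [x, y, x, y, x].Sublist (P ++ (Q ++ (R ++ S))) := by
  intro h
  have h1 := sublist_of_sublist_append_of_notMem h hP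
  have h2 := sublist_of_sublist_append_of_notMem h1 hQ.symm
  have h3 := sublist_of_sublist_append_of_notMem h2 hR
  rcases hS with hS | hS
  · exact hS (h3.subset (by simp))
  · exact hS (h3.subset (by simp))

/-- A word without adjacent equal letters can use only one of the two copies of each entry. -/
theorem sublist_of_sublist_flatMap_pair {γ : Type*} {u l : List γ} (hu : u.IsChain (· ≠ ·))
    (h : u.Sublist (l.flatMap fun a => [a, a])) : u.Sublist l := by
  induction l generalizing u with
  | nil => simpa using h
  | cons a l ih =>
    cases u with
    | nil => simp
    | cons b u =>
      simp only [List.flatMap_cons, List.cons_append, List.nil_append] at h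
      by_cases hab : b = a
      · subst hab
        refine List.Sublist.cons_cons _ (ih hu.tail ?_)
        have h1 := List.cons_sublist_cons.1 h
        cases u with
        | nil => simp
        | cons c u =>
          have : b ≠ c := (List.isChain_cons_cons.1 hu).1
          exact (List.sublist_cons_iff.1 h1).resolve_right
            (by rintro ⟨r, hr, -⟩; exact this (List.cons.inj hr).1.symm)
      · refine (ih hu ?_).cons _
        have h1 := (List.sublist_cons_iff.1 h).resolve_right
            (by rintro ⟨r, hr, -⟩; exact hab (List.cons.inj hr).1)
        exact (List.sublist_cons_iff.1 h1).resolve_right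
            (by rintro ⟨r, hr, -⟩; exact hab (List.cons.inj hr).1)

/-! ### Lower bound: words with marked blocks and the merging of letters into a copy -/

/-- An entry of a word with marked blocks: either a letter, or a block of letters, each of which is
flagged by `true` (it occurs here for the first time) or by `false` (for the last time). -/
abbrev Item (α : Type*) := α ⊕ List (Bool × α)

namespace Item

variable {α β : Type*}

def flags : Item α → List (Bool × α) := Sum.elim (fun _ => []) id

def letters : Item α → List α := Sum.elim (fun a => [a]) (fun B => B.map Prod.snd)

@[simp] theorem flags_inl (a : α) : flags (Sum.inl a : Item α) = [] := rfl
@[simp] theorem flags_inr (B : List (Bool × α)) : flags (Sum.inr B : Item α) = B := rfl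
@[simp] theorem letters_inl (a : α) : letters (Sum.inl a : Item α) = [a] := rfl
@[simp] theorem letters_inr (B : List (Bool × α)) :
    letters (Sum.inr B : Item α) = B.map Prod.snd := rfl

/-- The flags of two items, of which the first one precedes the second one, are respected. -/
def Respects (I J : Item α) : Prop :=
  (∀ a, (true, a) ∈ flags J → a ∉ letters I) ∧ ∀ a, (false, a) ∈ flags I → a ∉ letters J

/-- The underlying word. -/
def flat (Z : List (Item α)) : List α := Z.flatMap letters

/-- The number of blocks. -/
def blocks (Z : List (Item α)) : ℕ := Z.countP Sum.isRight

/-- The number of adjacent equal letters outside the blocks. -/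
noncomputable def repeats (Z : List (Item α)) : ℕ := adjEq (fun I => I.isLeft) Z

@[simp] theorem flat_nil : flat ([] : List (Item α)) = [] := rfl
@[simp] theorem flat_cons (I : Item α) (Z : List (Item α)) :
    flat (I :: Z) = letters I ++ flat Z := by simp [flat]
@[simp] theorem flat_append (Y Z : List (Item α)) : flat (Y ++ Z) = flat Y ++ flat Z := by
  simp [flat]
@[simp] theorem blocks_nil : blocks ([] : List (Item α)) = 0 := rfl
@[simp] theorem blocks_inl (a : α) (Z : List (Item α)) :
    blocks (Sum.inl a :: Z) = blocks Z := by simp [blocks]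
@[simp] theorem blocks_inr (B : List (Bool × α)) (Z : List (Item α)) :
    blocks (Sum.inr B :: Z) = blocks Z + 1 := by
  rw [blocks, List.countP_cons_of_pos (by rfl), blocks]
@[simp] theorem blocks_append (Y Z : List (Item α)) : blocks (Y ++ Z) = blocks Y + blocks Z := by
  simp [blocks]

/-- `1` if the word starts with a block. -/
def startsWithBlock : List (Item α) → ℕ
  | Sum.inr _ :: _ => 1
  | _ => 0

theorem repeats_inr (B : List (Bool × α)) (Z : List (Item α)) :
    repeats (Sum.inr B :: Z) = repeats Z := by
  cases Z <;> simp [repeats, adjEq]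

theorem repeats_inl_inr (a : α) (B : List (Bool × α)) (Z : List (Item α)) :
    repeats (Sum.inl a :: Sum.inr B :: Z) = repeats Z := by
  rw [← repeats_inr B Z]
  simp [repeats, adjEq]

/-- The adjacent equal letters of the underlying word. -/
theorem adjEq_flat_le (Z : List (Item α)) (hZ : ∀ B, Sum.inr B ∈ Z → (B.map Prod.snd).Nodup) :
    adjEq (fun _ => True) (flat Z) ≤ repeats Z + 2 * blocks Z := by
  -- A leading block keeps one unit in reserve, which pays for its junction with a letter put in
  -- front.
  suffices h : adjEq (fun _ => True) (flat Z) + startsWithBlock Z ≤ repeats Z + 2 * blocks Z by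
    omega
  induction Z with
  | nil => simp [adjEq, startsWithBlock]
  | cons I Z ih =>
    have ih := ih fun B hB => hZ B (List.mem_cons_of_mem _ hB)
    match I, Z with
    | Sum.inr B, Z =>
      have h1 := adjEq_append_le (fun _ => True) (B.map Prod.snd) (flat Z)
      rw [adjEq_eq_zero_of_nodup _ (hZ B (by simp))] at h1
      simp only [flat_cons, letters_inr, blocks_inr, repeats_inr, startsWithBlock]
      omega
    | Sum.inl a, [] => simp [adjEq, startsWithBlock]
    | Sum.inl a, Sum.inl b :: Z =>
      simp only [repeats, flat_cons, letters_inl, List.cons_append, List.nil_append, adjEq,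
        blocks_inl, startsWithBlock] at ih ⊢
      by_cases hab : a = b
      · subst hab
        simp only [Sum.isLeft_inl, and_self, if_true]
        omega
      · rw [if_neg fun h => hab h.1]
        omega
    | Sum.inl a, Sum.inr B :: Z =>
      have h1 := adjEq_cons_le (fun _ => True) a (flat (Sum.inr B :: Z))
      rw [repeats_inr] at ih
      rw [repeats_inl_inr, flat_cons, blocks_inl]
      simp only [letters_inl, List.cons_append, List.nil_append, startsWithBlock] at ih h1 ⊢
      omega

/-- Insert the letters of `B` into the blocks of the `i`-th copy of a word, one letter into each
block, and repeat each of them next to its block. -/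
def merge (i : ℕ) : List (Item β) → List (Bool × α) → List (Item (α ⊕ ℕ × β))
  | [], _ => []
  | Sum.inl b :: Z, B => Sum.inl (Sum.inr (i, b)) :: merge i Z B
  | Sum.inr C :: Z, [] => Sum.inr (C.map fun p => (p.1, Sum.inr (i, p.2))) :: merge i Z []
  -- The order keeps the flags valid: a first occurrence goes into the block before its duplicate, a
  -- last occurrence after it. In both cases the two copies are adjacent in the flat word.
  | Sum.inr C :: Z, (true, a) :: B =>
    Sum.inr ((C.map fun p => (p.1, Sum.inr (i, p.2))) ++ [(true, Sum.inl a)]) ::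
      Sum.inl (Sum.inl a) :: merge i Z B
  | Sum.inr C :: Z, (false, a) :: B =>
    Sum.inl (Sum.inl a) ::
      Sum.inr ((false, Sum.inl a) :: C.map fun p => (p.1, Sum.inr (i, p.2))) :: merge i Z B

/-- Replace the blocks by copies of `Z'`, into which the letters of the block are merged. -/
def expand (Z' : List (Item β)) : ℕ → List (Item α) → List (Item (α ⊕ ℕ × β))
  | _, [] => []
  | i, Sum.inl a :: Z => Sum.inl (Sum.inl a) :: expand Z' i Z
  | i, Sum.inr B :: Z => merge i Z' B ++ expand Z' (i + 1) Z

/-- Select the letters of the `j`-th copy. -/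
def copyLetter (j : ℕ) : α ⊕ ℕ × β → Option β :=
  Sum.elim (fun _ => none) (fun p => if p.1 = j then some p.2 else none)

@[simp] theorem copyLetter_inl (j : ℕ) (a : α) :
    copyLetter j (Sum.inl a : α ⊕ ℕ × β) = none := rfl

@[simp] theorem copyLetter_inr (j : ℕ) (p : ℕ × β) :
    copyLetter j (Sum.inr p : α ⊕ ℕ × β) = if p.1 = j then some p.2 else none := rfl

theorem blocks_merge (i : ℕ) (Z : List (Item β)) (B : List (Bool × α)) :
    blocks (merge i Z B) = blocks Z := by
  fun_induction merge i Z B <;> simp [*]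

theorem length_flat_merge (i : ℕ) (Z : List (Item β)) (B : List (Bool × α))
    (h : B.length = blocks Z) :
    (flat (merge i Z B)).length = (flat Z).length + 2 * B.length := by
  fun_induction merge i Z B <;> simp_all <;> omega

theorem filterMap_getLeft_merge (i : ℕ) (Z : List (Item β)) (B : List (Bool × α))
    (h : B.length = blocks Z) :
    (flat (merge i Z B)).filterMap Sum.getLeft? = (B.map Prod.snd).flatMap fun a => [a, a] := by
  fun_induction merge i Z B <;> simp_all [List.filterMap_map, Function.comp_def, List.filterMap_cons]

theorem filterMap_copyLetter_merge (i j : ℕ) (Z : List (Item β)) (B : List (Bool × α)) :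
    (flat (merge i Z B)).filterMap (copyLetter j) = if i = j then flat Z else [] := by
  have hC : ∀ C : List (Bool × β), (C.map fun p => (Sum.inr (i, p.2) : α ⊕ ℕ × β)).filterMap
      (copyLetter j) = if i = j then C.map Prod.snd else [] := by
    intro C
    induction C with
    | nil => simp
    | cons p C ih =>
      rw [List.map_cons, List.filterMap_cons, ih]
      split_ifs with h <;> simp [h]
  fun_induction merge i Z B <;> split_ifs at * <;>
    simp_all [-List.filterMap_eq_nil_iff, List.filterMap_cons, Function.comp_def]

theorem mem_of_inl_mem_flat_merge {i : ℕ} {Z : List (Item β)} {B : List (Bool × α)}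
    (h : B.length = blocks Z) {a : α} (ha : Sum.inl a ∈ flat (merge i Z B)) :
    a ∈ B.map Prod.snd := by
  have : a ∈ (flat (merge i Z B)).filterMap Sum.getLeft? :=
    List.mem_filterMap.2 ⟨_, ha, rfl⟩
  rw [filterMap_getLeft_merge i Z B h] at this
  simpa using this

theorem mem_of_inr_mem_flat_merge {i j : ℕ} {Z : List (Item β)} {B : List (Bool × α)}
    {b : β} (hb : Sum.inr (j, b) ∈ flat (merge i Z B)) : j = i ∧ b ∈ flat Z := by
  have : b ∈ (flat (merge i Z B)).filterMap (copyLetter j) :=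
    List.mem_filterMap.2 ⟨_, hb, by simp [copyLetter]⟩
  rw [filterMap_copyLetter_merge] at this
  split_ifs at this with h
  · exact ⟨h.symm, this⟩
  · simp at this

/-- This adjacency is what prevents a letter of a copy from separating the two inserted occurrences
of `a`. -/
theorem exists_split_merge (i : ℕ) (Z : List (Item β)) (B : List (Bool × α))
    (h : B.length = blocks Z) (hB : (B.map Prod.snd).Nodup) {a : α} (ha : a ∈ B.map Prod.snd) :
    ∃ P Q, flat (merge i Z B) = P ++ ([Sum.inl a, Sum.inl a] ++ Q) ∧ Sum.inl a ∉ P ∧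
      Sum.inl a ∉ Q := by
  fun_induction merge i Z B with
  | case1 B => simp_all
  | case2 b Z B ih =>
    obtain ⟨P, Q, h1, h2, h3⟩ := ih (by simpa using h) hB ha
    exact ⟨Sum.inr (i, b) :: P, Q, by simp [h1], by simpa using h2, h3⟩
  | case3 C Z ih => simp at ha
  | case4 C Z a' B ih =>
    simp only [List.map_cons, List.nodup_cons] at hB
    have h' : B.length = blocks Z := by simpa using h
    by_cases haa : a = a'
    · subst haa
      exact ⟨C.map fun p => Sum.inr (i, p.2), flat (merge i Z B), by simp, by simp,
        fun h'' => hB.1 (mem_of_inl_mem_flat_merge h' h'')⟩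
    · obtain ⟨P, Q, h1, h2, h3⟩ := ih h' hB.2 (by simpa [haa] using ha)
      exact ⟨(C.map fun p => Sum.inr (i, p.2)) ++ Sum.inl a' :: Sum.inl a' :: P, Q,
        by simp [h1], by simp [h2, haa], h3⟩
  | case5 C Z a' B ih =>
    simp only [List.map_cons, List.nodup_cons] at hB
    have h' : B.length = blocks Z := by simpa using h
    by_cases haa : a = a'
    · subst haa
      exact ⟨[], (C.map fun p => Sum.inr (i, p.2)) ++ flat (merge i Z B), by simp, by simp,
        by simpa using fun h'' => hB.1 (mem_of_inl_mem_flat_merge h' h'')⟩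
    · obtain ⟨P, Q, h1, h2, h3⟩ := ih h' hB.2 (by simpa [haa] using ha)
      exact ⟨Sum.inl a' :: Sum.inl a' :: (C.map fun p => Sum.inr (i, p.2)) ++ P, Q,
        by simp [h1], by simp [h2, haa], h3⟩

theorem block_merge {i m : ℕ} {Z : List (Item β)} {B : List (Bool × α)}
    (h : B.length = blocks Z)
    (hZ : ∀ C, Sum.inr C ∈ Z → C.length = m ∧ (C.map Prod.snd).Nodup) {C}
    (hC : Sum.inr C ∈ merge i Z B) : C.length = m + 1 ∧ (C.map Prod.snd).Nodup := by
  have hinj : Function.Injective fun b : β => (Sum.inr (i, b) : α ⊕ ℕ × β) := by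
    intro b c hbc
    simpa using hbc
  have hmap : ∀ C : List (Bool × β), (C.map Prod.snd).Nodup →
      (C.map fun p => (Sum.inr (i, p.2) : α ⊕ ℕ × β)).Nodup := by
    intro C hC
    have := hC.map hinj
    rwa [List.map_map] at this
  fun_induction merge i Z B with
  | case1 B => simp at hC
  | case2 b Z B ih =>
    exact ih (by simpa using h) (fun D hD => hZ D (by simp [hD])) (by simpa using hC)
  | case3 D Z ih => simp at h
  | case4 D Z a B ih =>
    simp only [List.mem_cons, Sum.inr.injEq, reduceCtorEq, false_or] at hC
    rcases hC with rfl | hC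
    · obtain ⟨h1, h2⟩ := hZ D (by simp)
      refine ⟨by simp [h1], ?_⟩
      simp only [List.map_append, List.map_map, List.map_cons, List.map_nil]
      rw [List.nodup_append]
      refine ⟨hmap D h2, by simp, by simp⟩
    · exact ih (by simpa using h) (fun D hD => hZ D (by simp [hD])) hC
  | case5 D Z a B ih =>
    simp only [List.mem_cons, Sum.inr.injEq, reduceCtorEq, false_or] at hC
    rcases hC with rfl | hC
    · obtain ⟨h1, h2⟩ := hZ D (by simp)
      refine ⟨by simp [h1], ?_⟩
      simp only [List.map_map, List.map_cons, List.nodup_cons]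
      exact ⟨by simp, hmap D h2⟩
    · exact ih (by simpa using h) (fun D hD => hZ D (by simp [hD])) hC

end Item
namespace Item

variable {α β : Type*}

theorem mem_letters_of_mem_flags {I : Item α} {t : Bool} {a : α} (h : (t, a) ∈ flags I) :
    a ∈ letters I := by
  cases I with
  | inl b => simp at h
  | inr B => exact List.mem_map.2 ⟨_, h, rfl⟩

theorem mem_flat {Z : List (Item α)} {a : α} : a ∈ flat Z ↔ ∃ I ∈ Z, a ∈ letters I :=
  List.mem_flatMap

open Classical in
theorem repeats_inl (a : α) (Z : List (Item α)) :
    repeats (Sum.inl a :: Z) = (if Z.head? = some (Sum.inl a) then 1 else 0) + repeats Z := by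
  cases Z with
  | nil => simp [repeats, adjEq]
  | cons I Z =>
    simp only [repeats, adjEq, List.head?_cons, Option.some.injEq]
    by_cases h : I = Sum.inl a
    · simp [h]
    · rw [if_neg h, if_neg fun h' => h h'.1.symm]

theorem repeats_append_le (Y Z : List (Item α)) :
    repeats (Y ++ Z) ≤ repeats Y + repeats Z + 1 := adjEq_append_le _ Y Z

theorem head?_merge {i : ℕ} {Z : List (Item β)} {B : List (Bool × α)} {b : β}
    (h : (merge i Z B).head? = some (Sum.inl (Sum.inr (i, b)))) :
    Z.head? = some (Sum.inl b) := by
  fun_cases merge i Z B <;> simp_all [merge]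

/-- Each duplicate has its block on one side; a duplicate of another inserted letter on the other
side is different, because `B` has no repetitions. -/
theorem repeats_merge_le (i : ℕ) (Z : List (Item β)) (B : List (Bool × α))
    (h : B.length = blocks Z) (hB : (B.map Prod.snd).Nodup) :
    repeats (merge i Z B) ≤ repeats Z := by
  classical
  have hne : ∀ (Z : List (Item β)) (a : α) (B : List (Bool × α)), B.length = blocks Z →
      a ∉ B.map Prod.snd → (merge i Z B).head? ≠ some (Sum.inl (Sum.inl a)) := by
    intro Z a B hBZ ha h'
    refine ha (mem_of_inl_mem_flat_merge hBZ (i := i) (mem_flat.2 ⟨_, List.mem_of_mem_head? h', ?_⟩))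
    simp
  fun_induction merge i Z B with
  | case1 B => simp [repeats, adjEq]
  | case2 b Z B ih =>
    have ih := ih (by simpa using h) hB
    rw [repeats_inl, repeats_inl]
    split_ifs with h1 h2
    · omega
    · exact (h2 (head?_merge h1)).elim
    · omega
    · omega
  | case3 C Z ih => simp at h
  | case4 C Z a B ih =>
    simp only [List.map_cons, List.nodup_cons] at hB
    have h' : B.length = blocks Z := by simpa using h
    rw [repeats_inr, repeats_inr, repeats_inl, if_neg (hne Z a B h' hB.1)]
    have := ih h' hB.2
    omega
  | case5 C Z a B ih =>
    simp only [List.map_cons, List.nodup_cons] at hB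
    have h' : B.length = blocks Z := by simpa using h
    rw [repeats_inl_inr, repeats_inr]
    exact ih h' hB.2

theorem flags_merge_inl {i : ℕ} {Z : List (Item β)} {B : List (Bool × α)}
    {J : Item (α ⊕ ℕ × β)} (hJ : J ∈ merge i Z B) {t : Bool} {a : α}
    (ha : (t, Sum.inl a) ∈ flags J) : (t, a) ∈ B := by
  fun_induction merge i Z B with
  | case1 B => simp at hJ
  | case2 b Z B ih =>
    rcases List.mem_cons.1 hJ with rfl | hJ
    · simp at ha
    · exact ih hJ
  | case3 C Z ih =>
    rcases List.mem_cons.1 hJ with rfl | hJ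
    · simp at ha
    · exact ih hJ
  | case4 C Z a' B ih =>
    simp only [List.mem_cons] at hJ ⊢
    rcases hJ with rfl | rfl | hJ
    · simp at ha; simp [ha]
    · simp at ha
    · exact Or.inr (ih hJ)
  | case5 C Z a' B ih =>
    simp only [List.mem_cons] at hJ ⊢
    rcases hJ with rfl | rfl | hJ
    · simp at ha
    · simp at ha; simp [ha]
    · exact Or.inr (ih hJ)

theorem flags_merge_inr {i j : ℕ} {Z : List (Item β)} {B : List (Bool × α)}
    {J : Item (α ⊕ ℕ × β)} (hJ : J ∈ merge i Z B) {t : Bool} {b : β}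
    (hb : (t, Sum.inr (j, b)) ∈ flags J) : ∃ J' ∈ Z, (t, b) ∈ flags J' := by
  have hC : ∀ C : List (Bool × β), (t, (Sum.inr (j, b) : α ⊕ ℕ × β)) ∈
      (C.map fun p => (p.1, (Sum.inr (i, p.2) : α ⊕ ℕ × β))) → (t, b) ∈ C := by
    intro C h
    obtain ⟨⟨t', b'⟩, h1, h2⟩ := List.mem_map.1 h
    simp only [Prod.mk.injEq, Sum.inr.injEq] at h2
    obtain ⟨rfl, -, rfl⟩ := h2
    exact h1
  fun_induction merge i Z B with
  | case1 B => simp at hJ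
  | case2 b Z B ih =>
    rcases List.mem_cons.1 hJ with rfl | hJ
    · simp at hb
    · obtain ⟨J', h1, h2⟩ := ih hJ
      exact ⟨J', List.mem_cons_of_mem _ h1, h2⟩
  | case3 C Z ih =>
    rcases List.mem_cons.1 hJ with rfl | hJ
    · exact ⟨_, List.mem_cons_self, hC C hb⟩
    · obtain ⟨J', h1, h2⟩ := ih hJ
      exact ⟨J', List.mem_cons_of_mem _ h1, h2⟩
  | case4 C Z a' B ih =>
    simp only [List.mem_cons] at hJ
    rcases hJ with rfl | rfl | hJ
    · rw [flags_inr, List.mem_append] at hb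
      exact ⟨_, List.mem_cons_self, hC C (hb.resolve_right (by simp))⟩
    · simp at hb
    · obtain ⟨J', h1, h2⟩ := ih hJ
      exact ⟨J', List.mem_cons_of_mem _ h1, h2⟩
  | case5 C Z a' B ih =>
    simp only [List.mem_cons] at hJ
    rcases hJ with rfl | rfl | hJ
    · simp at hb
    · rw [flags_inr, List.mem_cons] at hb
      exact ⟨_, List.mem_cons_self, hC C (hb.resolve_left (by simp))⟩
    · obtain ⟨J', h1, h2⟩ := ih hJ
      exact ⟨J', List.mem_cons_of_mem _ h1, h2⟩

theorem pairwise_merge {i : ℕ} {Z : List (Item β)} {B : List (Bool × α)}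
    (h : B.length = blocks Z) (hB : (B.map Prod.snd).Nodup) (hZ : Z.Pairwise Respects) :
    (merge i Z B).Pairwise Respects := by
  have hinl : ∀ (Z : List (Item β)) (B : List (Bool × α)) (a : α), a ∉ B.map Prod.snd →
      ∀ J ∈ merge i Z B, Respects (Sum.inl (Sum.inl a)) J := by
    intro Z B a ha J hJ
    refine ⟨fun c hc h' => ?_, fun c hc => by simp at hc⟩
    rw [letters_inl, List.mem_singleton] at h'
    subst h'
    exact ha (List.mem_map.2 ⟨_, flags_merge_inl hJ hc, rfl⟩)
  have hcopy : ∀ (Z : List (Item β)) (B : List (Bool × α)) (C : List (Bool × β)),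
      (∀ J ∈ Z, Respects (Sum.inr C) J) → ∀ J ∈ merge i Z B,
      Respects (Sum.inr (C.map fun p => (p.1, (Sum.inr (i, p.2) : α ⊕ ℕ × β)))) J := by
    intro Z B C hC J hJ
    refine ⟨fun c hc h' => ?_, fun c hc h' => ?_⟩
    · simp only [letters_inr, List.map_map, List.mem_map, Function.comp_def] at h'
      obtain ⟨p, hp, rfl⟩ := h'
      obtain ⟨J', hJ', hb⟩ := flags_merge_inr hJ hc
      exact (hC J' hJ').1 _ hb (List.mem_map.2 ⟨p, hp, rfl⟩)
    · simp only [flags_inr, List.mem_map, Prod.mk.injEq] at hc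
      obtain ⟨p, hp, hp1, rfl⟩ := hc
      have := (mem_of_inr_mem_flat_merge (mem_flat.2 ⟨J, hJ, h'⟩)).2
      obtain ⟨J', hJ', hb⟩ := mem_flat.1 this
      refine (hC J' hJ').2 _ ?_ hb
      rw [← hp1]
      exact hp
  fun_induction merge i Z B with
  | case1 B => simp
  | case2 b Z B ih =>
    rw [List.pairwise_cons] at hZ ⊢
    refine ⟨fun J hJ => ⟨fun c hc h' => ?_, fun c hc => by simp at hc⟩,
      ih (by simpa using h) hB hZ.2⟩
    rw [letters_inl, List.mem_singleton] at h'
    subst h'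
    obtain ⟨J', hJ', hb⟩ := flags_merge_inr hJ hc
    exact (hZ.1 J' hJ').1 _ hb (by simp)
  | case3 C Z ih => simp at h
  | case4 C Z a B ih =>
    simp only [List.map_cons, List.nodup_cons] at hB
    have h' : B.length = blocks Z := by simpa using h
    rw [List.pairwise_cons] at hZ
    rw [List.pairwise_cons, List.pairwise_cons]
    refine ⟨fun J hJ => ?_, hinl Z B a hB.1, ih h' hB.2 hZ.2⟩
    rcases List.mem_cons.1 hJ with rfl | hJ
    · refine ⟨fun c hc => by simp at hc, fun c hc => ?_⟩
      simp only [flags_inr, List.mem_append, List.mem_map, Prod.mk.injEq, List.mem_singleton,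
        Bool.false_eq_true, false_and, or_false] at hc
      obtain ⟨p, -, -, rfl⟩ := hc
      simp
    · have h1 := hcopy Z B C hZ.1 J hJ
      have h2 := hinl Z B a hB.1 J hJ
      refine ⟨fun c hc h3 => ?_, fun c hc => ?_⟩
      · rw [letters_inr, List.map_append, List.mem_append] at h3
        rcases h3 with h3 | h3
        · exact h1.1 c hc h3
        · exact h2.1 c hc (by simpa using h3)
      · rw [flags_inr, List.mem_append] at hc
        exact h1.2 c (hc.resolve_right (by simp))
  | case5 C Z a B ih =>
    simp only [List.map_cons, List.nodup_cons] at hB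
    have h' : B.length = blocks Z := by simpa using h
    rw [List.pairwise_cons] at hZ
    rw [List.pairwise_cons, List.pairwise_cons]
    refine ⟨fun J hJ => ?_, fun J hJ => ?_, ih h' hB.2 hZ.2⟩
    · rcases List.mem_cons.1 hJ with rfl | hJ
      · refine ⟨fun c hc => ?_, fun c hc => by simp at hc⟩
        simp only [flags_inr, List.mem_cons, List.mem_map, Prod.mk.injEq,
          Bool.true_eq_false, false_and, false_or] at hc
        obtain ⟨p, -, -, rfl⟩ := hc
        simp
      · exact hinl Z B a hB.1 J hJ
    · have h1 := hcopy Z B C hZ.1 J hJ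
      have h2 := hinl Z B a hB.1 J hJ
      refine ⟨fun c hc h3 => ?_, fun c hc h3 => ?_⟩
      · rw [letters_inr, List.map_cons, List.mem_cons] at h3
        rcases h3 with h3 | h3
        · exact h2.1 c hc (by simpa using h3)
        · exact h1.1 c hc h3
      · rw [flags_inr, List.mem_cons] at hc
        rcases hc with hc | hc
        · simp only [Prod.mk.injEq, true_and] at hc
          subst hc
          exact hB.1 (mem_of_inl_mem_flat_merge h' (mem_flat.2 ⟨J, hJ, h3⟩))
        · exact h1.2 c hc h3

/-! ### Lower bound: expansion of all blocks -/

theorem expand_append (Z' : List (Item β)) (i : ℕ) (X Y : List (Item α)) :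
    expand Z' i (X ++ Y) = expand Z' i X ++ expand Z' (i + blocks X) Y := by
  induction X generalizing i with
  | nil => simp [expand]
  | cons I X ih =>
    cases I with
    | inl a => simp [expand, ih]
    | inr B =>
      simp only [List.cons_append, expand, ih, blocks_inr, List.append_assoc]
      rw [show i + 1 + blocks X = i + (blocks X + 1) by ring]

theorem blocks_expand (Z' : List (Item β)) (i : ℕ) (Z : List (Item α)) :
    blocks (expand Z' i Z) = blocks Z * blocks Z' := by
  induction Z generalizing i with
  | nil => simp [expand]
  | cons I Z ih =>
    cases I with
    | inl a => simp [expand, ih]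
    | inr B => simp [expand, ih, blocks_merge]; ring

theorem length_flat_expand (Z' : List (Item β)) (i : ℕ) (Z : List (Item α))
    (h : ∀ B, Sum.inr B ∈ Z → B.length = blocks Z') :
    (flat (expand Z' i Z)).length =
      (flat Z).length + blocks Z * ((flat Z').length + blocks Z') := by
  induction Z generalizing i with
  | nil => simp [expand]
  | cons I Z ih =>
    have ih := fun i => ih i fun B hB => h B (List.mem_cons_of_mem _ hB)
    cases I with
    | inl a => simp [expand, ih]; ring
    | inr B =>
      have hB := h B List.mem_cons_self
      simp [expand, ih, length_flat_merge i Z' B hB, hB]; ring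

theorem filterMap_getLeft_expand (Z' : List (Item β)) (i : ℕ) (Z : List (Item α))
    (h : ∀ B, Sum.inr B ∈ Z → B.length = blocks Z') :
    ((flat (expand Z' i Z)).filterMap Sum.getLeft?).Sublist
      ((flat Z).flatMap fun a => [a, a]) := by
  induction Z generalizing i with
  | nil => simp [expand]
  | cons I Z ih =>
    have ih := fun i => ih i fun B hB => h B (List.mem_cons_of_mem _ hB)
    cases I with
    | inl a =>
      simp only [expand, flat_cons, letters_inl, List.cons_append, List.nil_append,
        List.flatMap_cons, List.filterMap_cons, Sum.getLeft?_inl]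
      exact ((ih i).cons _).cons_cons _
    | inr B =>
      simp only [expand, flat_append, flat_cons, letters_inr, List.filterMap_append,
        List.flatMap_append, filterMap_getLeft_merge i Z' B (h B List.mem_cons_self)]
      exact (ih _).append_left _

theorem mem_of_inl_mem_flat_expand {Z' : List (Item β)} {i : ℕ} {Z : List (Item α)}
    (h : ∀ B, Sum.inr B ∈ Z → B.length = blocks Z') {a : α}
    (ha : Sum.inl a ∈ flat (expand Z' i Z)) : a ∈ flat Z := by
  have : a ∈ (flat (expand Z' i Z)).filterMap Sum.getLeft? := List.mem_filterMap.2 ⟨_, ha, rfl⟩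
  simpa using (filterMap_getLeft_expand Z' i Z h).subset this

theorem filterMap_copyLetter_expand (Z' : List (Item β)) (i j : ℕ) (Z : List (Item α)) :
    (flat (expand Z' i Z)).filterMap (copyLetter j) =
      if i ≤ j ∧ j < i + blocks Z then flat Z' else [] := by
  induction Z generalizing i with
  | nil => rw [if_neg (by simp)]; simp [expand]
  | cons I Z ih =>
    cases I with
    | inl a =>
      simp only [expand, flat_cons, letters_inl, List.cons_append, List.nil_append,
        List.filterMap_cons, copyLetter_inl, ih, blocks_inl]
    | inr B =>
      simp only [expand, flat_append, List.filterMap_append, filterMap_copyLetter_merge, ih,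
        blocks_inr]
      by_cases h1 : i = j
      · rw [if_pos h1, if_neg (by omega), if_pos (by omega), List.append_nil]
      · rw [if_neg h1, List.nil_append]
        exact if_congr (by omega) rfl rfl

theorem mem_of_inr_mem_flat_expand {Z' : List (Item β)} {i j : ℕ} {Z : List (Item α)} {b : β}
    (hb : Sum.inr (j, b) ∈ flat (expand Z' i Z)) :
    (i ≤ j ∧ j < i + blocks Z) ∧ b ∈ flat Z' := by
  have : b ∈ (flat (expand Z' i Z)).filterMap (copyLetter j) :=
    List.mem_filterMap.2 ⟨_, hb, by simp⟩
  rw [filterMap_copyLetter_expand] at this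
  split_ifs at this with h
  · exact ⟨h, this⟩
  · simp at this

theorem exists_block_of_lt {Z : List (Item α)} {j : ℕ} (hj : j < blocks Z) :
    ∃ X B Y, Z = X ++ Sum.inr B :: Y ∧ blocks X = j := by
  induction Z generalizing j with
  | nil => simp at hj
  | cons I Z ih =>
    cases I with
    | inl a =>
      obtain ⟨X, B, Y, rfl, h⟩ := ih (by simpa using hj)
      exact ⟨Sum.inl a :: X, B, Y, rfl, by simpa using h⟩
    | inr B =>
      cases j with
      | zero => exact ⟨[], B, Z, rfl, rfl⟩
      | succ j =>
        obtain ⟨X, C, Y, rfl, h⟩ := ih (by simpa using hj)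
        exact ⟨Sum.inr B :: X, C, Y, rfl, by simpa using h⟩

theorem block_expand {m i : ℕ} {Z' : List (Item β)} {Z : List (Item α)}
    (h : ∀ B, Sum.inr B ∈ Z → B.length = blocks Z')
    (hZ' : ∀ C, Sum.inr C ∈ Z' → C.length = m ∧ (C.map Prod.snd).Nodup) {C}
    (hC : Sum.inr C ∈ expand Z' i Z) : C.length = m + 1 ∧ (C.map Prod.snd).Nodup := by
  induction Z generalizing i with
  | nil => simp [expand] at hC
  | cons I Z ih =>
    have ih := fun i => ih (i := i) fun B hB => h B (List.mem_cons_of_mem _ hB)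
    cases I with
    | inl a => exact ih _ (by simpa [expand] using hC)
    | inr B =>
      rw [expand, List.mem_append] at hC
      rcases hC with hC | hC
      · exact block_merge (h B List.mem_cons_self) hZ' hC
      · exact ih _ hC

theorem flags_expand_inl {i : ℕ} {Z' : List (Item β)} {Z : List (Item α)}
    {J : Item (α ⊕ ℕ × β)} (hJ : J ∈ expand Z' i Z) {t : Bool} {a : α}
    (ha : (t, Sum.inl a) ∈ flags J) : ∃ J' ∈ Z, (t, a) ∈ flags J' := by
  induction Z generalizing i with
  | nil => simp [expand] at hJ
  | cons I Z ih =>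
    cases I with
    | inl b =>
      rw [expand, List.mem_cons] at hJ
      rcases hJ with rfl | hJ
      · simp at ha
      · obtain ⟨J', h1, h2⟩ := ih hJ
        exact ⟨J', List.mem_cons_of_mem _ h1, h2⟩
    | inr B =>
      rw [expand, List.mem_append] at hJ
      rcases hJ with hJ | hJ
      · exact ⟨_, List.mem_cons_self, flags_merge_inl hJ ha⟩
      · obtain ⟨J', h1, h2⟩ := ih hJ
        exact ⟨J', List.mem_cons_of_mem _ h1, h2⟩

theorem pairwise_expand {i : ℕ} {Z' : List (Item β)} {Z : List (Item α)}
    (h : ∀ B, Sum.inr B ∈ Z → B.length = blocks Z' ∧ (B.map Prod.snd).Nodup)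
    (hZ' : Z'.Pairwise Respects) (hZ : Z.Pairwise Respects) :
    (expand Z' i Z).Pairwise Respects := by
  induction Z generalizing i with
  | nil => simp [expand]
  | cons I Z ih =>
    have hlen : ∀ B, Sum.inr B ∈ Z → B.length = blocks Z' := fun B hB =>
      (h B (List.mem_cons_of_mem _ hB)).1
    rw [List.pairwise_cons] at hZ
    have ih := fun i => ih (i := i) (fun B hB => h B (List.mem_cons_of_mem _ hB)) hZ.2
    cases I with
    | inl a =>
      rw [expand, List.pairwise_cons]
      refine ⟨fun J hJ => ⟨fun c hc h' => ?_, fun c hc => by simp at hc⟩, ih i⟩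
      rw [letters_inl, List.mem_singleton] at h'
      subst h'
      obtain ⟨J', hJ', hb⟩ := flags_expand_inl hJ hc
      exact (hZ.1 J' hJ').1 _ hb (by simp)
    | inr B =>
      obtain ⟨hB, hBn⟩ := h B List.mem_cons_self
      rw [expand, List.pairwise_append]
      refine ⟨pairwise_merge hB hBn hZ', ih _, fun I hI J hJ => ⟨fun c hc h' => ?_,
        fun c hc h' => ?_⟩⟩
      · have hI' := mem_flat.2 ⟨I, hI, h'⟩
        have hJ' := mem_flat.2 ⟨J, hJ, mem_letters_of_mem_flags hc⟩
        rcases c with a | ⟨j, b⟩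
        · obtain ⟨J', hJ', hb⟩ := flags_expand_inl hJ hc
          exact (hZ.1 J' hJ').1 a hb (mem_of_inl_mem_flat_merge hB hI')
        · have h1 := (mem_of_inr_mem_flat_merge hI').1
          have h2 := (mem_of_inr_mem_flat_expand hJ').1
          omega
      · have hI' := mem_flat.2 ⟨I, hI, mem_letters_of_mem_flags hc⟩
        have hJ' := mem_flat.2 ⟨J, hJ, h'⟩
        rcases c with a | ⟨j, b⟩
        · obtain ⟨J', hJ', hb⟩ := mem_flat.1 (mem_of_inl_mem_flat_expand hlen hJ')
          exact (hZ.1 J' hJ').2 a (flags_merge_inl hI hc) hb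
        · have h1 := (mem_of_inr_mem_flat_merge hI').1
          have h2 := (mem_of_inr_mem_flat_expand hJ').1
          omega

/-- Each expanded block has two junctions with its surroundings, hence the 2. The term
`startsWithBlock` reserves the left one until a letter in front uses it. -/
theorem repeats_expand_le (i : ℕ) (Z' : List (Item β)) (Z : List (Item α))
    (h : ∀ B, Sum.inr B ∈ Z → B.length = blocks Z' ∧ (B.map Prod.snd).Nodup) :
    repeats (expand Z' i Z) + startsWithBlock Z ≤
      repeats Z + blocks Z * (repeats Z' + 2) := by
  classical
  induction Z generalizing i with
  | nil => simp [expand, startsWithBlock, repeats, adjEq]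
  | cons I Z ih =>
    have ih := fun i => ih i fun B hB => h B (List.mem_cons_of_mem _ hB)
    match I, Z with
    | Sum.inr B, Z =>
      obtain ⟨hB, hBn⟩ := h B List.mem_cons_self
      have h1 := repeats_append_le (merge i Z' B) (expand Z' (i + 1) Z)
      have h2 := repeats_merge_le i Z' B hB hBn
      have h3 := ih (i + 1)
      simp only [expand, repeats_inr, blocks_inr, startsWithBlock, add_mul, one_mul]
      omega
    | Sum.inl a, [] => simp [expand, startsWithBlock, repeats, adjEq]
    | Sum.inl a, Sum.inl b :: Z =>
      have h3 := ih i
      rw [expand, repeats_inl a]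
      simp only [expand, repeats_inl (Sum.inl a), blocks_inl, List.head?_cons,
        Option.some.injEq, startsWithBlock] at h3 ⊢
      by_cases hab : b = a
      · subst hab
        simp only [if_true]
        omega
      · have hab' : (Sum.inl (Sum.inl b) : Item (α ⊕ ℕ × β)) ≠ Sum.inl (Sum.inl a) := by
          simpa using hab
        rw [if_neg hab']
        omega
    | Sum.inl a, Sum.inr B :: Z =>
      have h3 := ih i
      have h1 : repeats (expand Z' i (Sum.inl a :: Sum.inr B :: Z)) ≤
          repeats (expand Z' i (Sum.inr B :: Z)) + 1 := adjEq_cons_le _ _ _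
      rw [repeats_inr] at h3
      rw [repeats_inl_inr, blocks_inl]
      simp only [startsWithBlock] at h3 ⊢
      omega

/-- A letter of the outer word and a letter of a copy: the whole word splits into four segments,
each of which misses one of the two. -/
theorem exists_four_segments {Z' : List (Item β)} {Z : List (Item α)}
    (h : ∀ B, Sum.inr B ∈ Z → B.length = blocks Z' ∧ (B.map Prod.snd).Nodup)
    (hZ : Z.Pairwise Respects) (a : α) (j : ℕ) (b : β) :
    ∃ P Q R S, flat (expand Z' 0 Z) = P ++ (Q ++ (R ++ S)) ∧
      (Sum.inl a ∉ P ∨ Sum.inr (j, b) ∉ P) ∧ (Sum.inl a ∉ Q ∨ Sum.inr (j, b) ∉ Q) ∧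
      (Sum.inl a ∉ R ∨ Sum.inr (j, b) ∉ R) ∧ (Sum.inl a ∉ S ∨ Sum.inr (j, b) ∉ S) := by
  by_cases hb : Sum.inr (j, b) ∈ flat (expand Z' 0 Z)
  swap
  · exact ⟨flat (expand Z' 0 Z), [], [], [], by simp, Or.inr hb, by simp, by simp, by simp⟩
  obtain ⟨⟨-, hj⟩, -⟩ := mem_of_inr_mem_flat_expand hb
  rw [zero_add] at hj
  obtain ⟨X, B, Y, rfl, hX⟩ := exists_block_of_lt hj
  obtain ⟨hB, hBn⟩ := h B (by simp)
  have hXl : ∀ B, Sum.inr B ∈ X → B.length = blocks Z' := fun B hB => (h B (by simp [hB])).1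
  have hYl : ∀ B, Sum.inr B ∈ Y → B.length = blocks Z' := fun B hB => (h B (by simp [hB])).1
  have hbX : Sum.inr (j, b) ∉ flat (expand Z' 0 X) := fun h' => by
    have := (mem_of_inr_mem_flat_expand h').1
    omega
  have hbY : Sum.inr (j, b) ∉ flat (expand Z' (j + 1) Y) := fun h' => by
    have := (mem_of_inr_mem_flat_expand h').1
    omega
  rw [expand_append, zero_add, hX, expand, flat_append, flat_append]
  by_cases ha : a ∈ B.map Prod.snd
  swap
  · exact ⟨_, _, _, [], by rw [List.append_nil], Or.inr hbX,
      Or.inl fun h' => ha (mem_of_inl_mem_flat_merge hB h'), Or.inr hbY, by simp⟩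
  obtain ⟨P, Q, hPQ, hP, hQ⟩ := exists_split_merge j Z' B hB hBn ha
  obtain ⟨⟨t, a'⟩, hta, rfl⟩ := List.mem_map.1 ha
  rw [List.pairwise_append, List.pairwise_cons] at hZ
  obtain ⟨-, ⟨hZ2, -⟩, hZ1⟩ := hZ
  rw [hPQ]
  -- By its flag, `a'` occurs outside the copy on one side only, while the copy letter lives inside
  -- the copy and the two inserted `a'` are adjacent. So the flag decides where the four cuts go.
  cases t with
  | true =>
    have haX : Sum.inl a' ∉ flat (expand Z' 0 X) := fun h' => by
      obtain ⟨I, hI, hI'⟩ := mem_flat.1 (mem_of_inl_mem_flat_expand hXl h')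
      exact (hZ1 I hI (Sum.inr B) List.mem_cons_self).1 a' hta hI'
    refine ⟨flat (expand Z' 0 X) ++ P, [Sum.inl a', Sum.inl a'], Q, flat (expand Z' (j + 1) Y),
      by simp, Or.inl ?_, Or.inr (by simp), Or.inl hQ, Or.inr hbY⟩
    simp only [List.mem_append, not_or]
    exact ⟨haX, hP⟩
  | false =>
    have haY : Sum.inl a' ∉ flat (expand Z' (j + 1) Y) := fun h' => by
      obtain ⟨I, hI, hI'⟩ := mem_flat.1 (mem_of_inl_mem_flat_expand hYl h')
      exact (hZ2 I hI).2 a' hta hI'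
    refine ⟨flat (expand Z' 0 X), P, [Sum.inl a', Sum.inl a'], Q ++ flat (expand Z' (j + 1) Y),
      by simp, Or.inr hbX, Or.inl hP, Or.inr (by simp), Or.inl ?_⟩
    simp only [List.mem_append, not_or]
    exact ⟨hQ, haY⟩

/-- Expansion creates no alternation `a b a b a`. -/
theorem not_sublist_flat_expand {Z' : List (Item β)} {Z : List (Item α)}
    (h : ∀ B, Sum.inr B ∈ Z → B.length = blocks Z' ∧ (B.map Prod.snd).Nodup)
    (hZ : Z.Pairwise Respects) (hf : ∀ x y, x ≠ y → ¬ [x, y, x, y, x].Sublist (flat Z))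
    (hf' : ∀ x y, x ≠ y → ¬ [x, y, x, y, x].Sublist (flat Z')) (x y : α ⊕ ℕ × β) (hxy : x ≠ y) :
    ¬ [x, y, x, y, x].Sublist (flat (expand Z' 0 Z)) := by
  intro hs
  rcases x with a | ⟨i, b⟩ <;> rcases y with a' | ⟨j, b'⟩
  · have h1 := (hs.filterMap Sum.getLeft?).trans
      (filterMap_getLeft_expand Z' 0 Z fun B hB => (h B hB).1)
    have hne : a ≠ a' := fun h' => hxy (by rw [h'])
    exact hf a a' hne (sublist_of_sublist_flatMap_pair (by simp [hne, hne.symm]) h1)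
  · obtain ⟨P, Q, R, S, h1, hP, hQ, hR, hS⟩ := exists_four_segments h hZ a j b'
    rw [h1] at hs
    exact not_sublist_of_four_segments hP hQ hR hS hs
  · obtain ⟨P, Q, R, S, h1, hP, hQ, hR, hS⟩ := exists_four_segments h hZ a' i b
    rw [h1] at hs
    exact not_sublist_of_four_segments hP.symm hQ.symm hR.symm hS.symm hs
  · by_cases hij : i = j
    · subst hij
      have h1 := hs.filterMap (copyLetter i)
      rw [filterMap_copyLetter_expand] at h1
      have hne : b ≠ b' := fun h' => hxy (by rw [h'])
      split_ifs at h1 with h2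
      · exact hf' b b' hne (by simpa using h1)
      · simp at h1
    · obtain ⟨⟨-, hj⟩, -⟩ := mem_of_inr_mem_flat_expand
        (hs.subset (show Sum.inr (j, b') ∈ _ by simp))
      rw [zero_add] at hj
      obtain ⟨X, B, Y, rfl, hX⟩ := exists_block_of_lt hj
      rw [expand_append, zero_add, hX, expand, flat_append, flat_append,
        ← List.append_nil (flat (expand Z' (j + 1) Y))] at hs
      refine not_sublist_of_four_segments (Or.inr fun h' => ?_) (Or.inl fun h' => ?_)
        (Or.inr fun h' => ?_) (by simp) hs
      · have := (mem_of_inr_mem_flat_expand h').1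
        omega
      · exact hij (mem_of_inr_mem_flat_merge h').1
      · have := (mem_of_inr_mem_flat_expand h').1
        omega

end Item
end DavenportSchinzel

/-! ### Lower bound: the iterated construction -/

namespace DavenportSchinzel
namespace Item

variable {α β : Type*}

/-- The properties of the words that are built by repeated expansion. -/
structure IsRich (d m f : ℕ) (Z : List (Item α)) : Prop where
  blocks_eq : blocks Z = f
  block : ∀ B, Sum.inr B ∈ Z → B.length = m ∧ (B.map Prod.snd).Nodup
  respects : Z.Pairwise Respects
  free : ∀ x y, x ≠ y → ¬ [x, y, x, y, x].Sublist (flat Z)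
  -- Twice the number of letters equals the number of block entries: one block for the first and one
  -- for the last occurrence. The next field then says that the length is (2d+3) times the size of
  -- `T`.
  card : ∃ T : Finset α, (∀ a ∈ flat Z, a ∈ T) ∧ 2 * T.card = f * m
  length_eq : 2 * (flat Z).length = (2 * d + 3) * (f * m)
  -- The summand 4(d+1) is slack that absorbs the two junctions per block in `repeats_expand_le`;
  -- the inequality is tight for `isRich_zero` and `isRich_block_zero`.
  repeats_le : repeats Z + 4 * (d + 1) ≤ 2 * (d + 1) * f

/-- The blocks of `Z` have as many letters as `Z'` has blocks. An outer letter gains one occurrence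
per block entry, two on average, and so rises from 2d+3 to 2d+5, the average already present in the
copies. -/
theorem IsRich.expand {d m f g : ℕ} {Z' : List (Item β)} {Z : List (Item α)}
    (hZ' : IsRich (d + 1) m f Z') (hZ : IsRich d f g Z) (hg : 2 ≤ g) :
    IsRich (d + 1) (m + 1) (f * g) (expand Z' 0 Z) := by
  have hlen : ∀ B, Sum.inr B ∈ Z → B.length = blocks Z' ∧ (B.map Prod.snd).Nodup := by
    rw [hZ'.blocks_eq]
    exact hZ.block
  refine ⟨?_, ?_, ?_, ?_, ?_, ?_, ?_⟩
  · rw [blocks_expand, hZ.blocks_eq, hZ'.blocks_eq, mul_comm]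
  · exact fun B hB => block_expand (fun B hB => (hlen B hB).1) hZ'.block hB
  · exact pairwise_expand hlen hZ'.respects hZ.respects
  · exact not_sublist_flat_expand hlen hZ.respects hZ.free hZ'.free
  · obtain ⟨T, hT, hTc⟩ := hZ.card
    obtain ⟨T', hT', hTc'⟩ := hZ'.card
    refine ⟨T.disjSum (Finset.range g ×ˢ T'), ?_, ?_⟩
    · rintro (a | ⟨j, b⟩) ha
      · exact Finset.inl_mem_disjSum.2
          (hT a (mem_of_inl_mem_flat_expand (fun B hB => (hlen B hB).1) ha))
      · obtain ⟨⟨-, h1⟩, h2⟩ := mem_of_inr_mem_flat_expand ha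
        rw [zero_add, hZ.blocks_eq] at h1
        exact Finset.inr_mem_disjSum.2
          (Finset.mem_product.2 ⟨Finset.mem_range.2 h1, hT' b h2⟩)
    · rw [Finset.card_disjSum, Finset.card_product, Finset.card_range]
      linear_combination hTc + g * hTc'
  · rw [length_flat_expand Z' 0 Z fun B hB => (hlen B hB).1, hZ.blocks_eq, hZ'.blocks_eq]
    linear_combination hZ.length_eq + g * hZ'.length_eq
  · have h1 := repeats_expand_le 0 Z' Z hlen
    rw [hZ.blocks_eq] at h1
    have h2 := hZ.repeats_le
    have h3 := Nat.mul_le_mul_left g hZ'.repeats_le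
    nlinarith

/-- The word is 0…m-1, then m-1…0, then 0…m-1, with the two increasing runs as blocks. For two
letters, each monotone run absorbs at most one letter of an alternation that starts against its
order. -/
theorem isRich_zero (m : ℕ) : ∃ Z : List (Item ℕ), IsRich 0 m 2 Z := by
  have hflat : ∀ l : List ℕ, flat (l.map fun a => (Sum.inl a : Item ℕ)) = l := by
    intro l
    induction l with
    | nil => rfl
    | cons a l ih => simp [ih]
  have hblocks : ∀ l : List ℕ, blocks (l.map fun a => (Sum.inl a : Item ℕ)) = 0 := by
    intro l
    induction l with
    | nil => rfl
    | cons a l ih => simp [ih]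
  have hinc : ∀ x y, x < y → ¬ [y, x].Sublist (List.range m) := fun x y hxy h => by
    have := (List.pairwise_lt_range (n := m)).sublist h
    simp at this
    omega
  have hdec : ∀ x y, x < y → ¬ [x, y].Sublist (List.range m).reverse := fun x y hxy h => by
    have := h.reverse
    rw [List.reverse_reverse] at this
    exact hinc x y hxy this
  refine ⟨Sum.inr ((List.range m).map fun a => (true, a)) ::
    (((List.range m).reverse.map fun a => Sum.inl a) ++
      [Sum.inr ((List.range m).map fun a => (false, a))]), ?_, ?_, ?_, ?_, ?_, ?_, ?_⟩
  · rw [blocks_inr, blocks_append, hblocks]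
    simp
  · intro B hB
    have hB' : B = (List.range m).map (fun a => (true, a)) ∨
        B = (List.range m).map (fun a => (false, a)) := by simpa using hB
    rcases hB' with rfl | rfl <;> simp [Function.comp_def, List.nodup_range]
  · rw [List.pairwise_cons, List.pairwise_append]
    refine ⟨?_, ?_, by simp, ?_⟩
    · intro J hJ
      rcases List.mem_append.1 hJ with hJ | hJ
      · obtain ⟨a, -, rfl⟩ := List.mem_map.1 hJ
        exact ⟨fun a ha => by simp at ha, fun a ha => by simp at ha⟩
      · rw [List.mem_singleton] at hJ
        subst hJ
        exact ⟨fun a ha => by simp at ha, fun a ha => by simp at ha⟩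
    · rw [List.pairwise_map]
      exact List.pairwise_of_forall fun a b =>
        ⟨fun a ha => by simp at ha, fun a ha => by simp at ha⟩
    · intro I hI J hJ
      obtain ⟨a, -, rfl⟩ := List.mem_map.1 hI
      rw [List.mem_singleton] at hJ
      subst hJ
      exact ⟨fun a ha => by simp at ha, fun a ha => by simp at ha⟩
  · intro x y hxy h
    rw [flat_cons, flat_append, hflat] at h
    simp only [letters_inr, List.map_map, flat_cons, flat_nil, List.append_nil,
      Function.comp_def, List.map_id'] at h
    rcases lt_or_gt_of_ne hxy with hlt | hlt
    · have h1 := sublist_of_sublist_append ((List.sublist_cons_self x _).trans h) (hinc x y hlt)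
      have h2 := sublist_of_sublist_append h1 (hdec x y hlt)
      exact hinc x y hlt h2
    · have h1 := sublist_of_sublist_append h (hinc y x hlt)
      have h2 := sublist_of_sublist_append h1 (hdec y x hlt)
      exact hinc y x hlt ((by simp : [x, y].Sublist [x, y, x]).trans h2)
  · refine ⟨Finset.range m, ?_, by simp⟩
    rw [flat_cons, flat_append, hflat]
    simp
  · rw [flat_cons, flat_append, hflat]
    simp
    ring
  · rw [repeats_inr, repeats, adjEq_eq_zero_of_nodup]
    rw [List.nodup_append]
    refine ⟨?_, by simp, by simp⟩
    exact (List.nodup_reverse.2 List.nodup_range).map fun a b h => by simpa using h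

theorem isRich_block_zero (d : ℕ) : IsRich d 0 2 ([Sum.inr [], Sum.inr []] : List (Item ℕ)) := by
  refine ⟨by simp, by simp, by simp [Respects], by simp, ⟨∅, by simp, by simp⟩, by simp, ?_⟩
  rw [repeats_inr, repeats_inr]
  simp [repeats, adjEq]
  omega

end Item

/-- The number of blocks in the construction. -/
def blockCount : ℕ → ℕ → ℕ
  | 0, _ => 2
  | _ + 1, 0 => 2
  | d + 1, m + 1 => blockCount (d + 1) m * blockCount d (blockCount (d + 1) m)

theorem two_le_blockCount (d m : ℕ) : 2 ≤ blockCount d m := by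
  fun_induction blockCount d m with
  | case1 => exact le_rfl
  | case2 => exact le_rfl
  | case3 d m ih1 ih2 => nlinarith

theorem exists_isRich (d m : ℕ) :
    ∃ (α : Type) (Z : List (Item α)), Item.IsRich d m (blockCount d m) Z := by
  induction d generalizing m with
  | zero =>
    obtain ⟨Z, hZ⟩ := Item.isRich_zero m
    exact ⟨ℕ, Z, by rwa [blockCount]⟩
  | succ d ihd =>
    induction m with
    | zero => exact ⟨ℕ, _, by rw [blockCount]; exact Item.isRich_block_zero _⟩
    | succ m ihm =>
      obtain ⟨β, Z', hZ'⟩ := ihm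
      obtain ⟨α, Z, hZ⟩ := ihd (blockCount (d + 1) m)
      refine ⟨α ⊕ ℕ × β, Item.expand Z' 0 Z, ?_⟩
      rw [blockCount]
      exact hZ'.expand hZ (two_le_blockCount _ _)

/-! ### Lower bound: superadditivity of λ₃ -/

theorem length_le_lambda_toFinset {α : Type*} [DecidableEq α] {S : List α}
    (hc : S.IsChain (· ≠ ·)) (hf : ∀ x y, x ≠ y → ¬ [x, y, x, y, x].Sublist S) :
    S.length ≤ lambda 3 S.toFinset.card := by
  have hinj : ∀ a ∈ S, ∀ b, S.idxOf a = S.idxOf b → a = b := fun a ha b h =>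
    (List.idxOf_inj ha).1 h
  refine (isGreatest_lambda 3 _ (by norm_num)).2
    ⟨S.map fun a => S.idxOf a, isDS_three_iff.2 ⟨?_, ?_⟩, ?_, by simp⟩
  · rw [List.isChain_iff_getElem] at hc ⊢
    intro i hi
    rw [List.length_map] at hi
    simp only [List.getElem_map]
    exact fun h => hc i hi (hinj _ (List.getElem_mem _) _ h)
  · intro x y hxy h
    obtain ⟨l, hl, hxl⟩ := List.sublist_map_iff.1 h
    match l, hxl, hl with
    | [_, _, _], hxl, _ => simp at hxl
    | [_, _, _, _], hxl, _ => simp at hxl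
    | _ :: _ :: _ :: _ :: _ :: _ :: _, hxl, _ => simp at hxl
    | [a, b, c, d, e], hxl, hl =>
      simp only [List.map_cons, List.map_nil, List.cons.injEq, and_true] at hxl
      obtain ⟨h1, h2, h3, h4, h5⟩ := hxl
      have hm : ∀ z ∈ [a, b, c, d, e], z ∈ S := hl.subset
      have hac := hinj a (hm a (by simp)) c (h1.symm.trans h3)
      have hbd := hinj b (hm b (by simp)) d (h2.symm.trans h4)
      have hae := hinj a (hm a (by simp)) e (h1.symm.trans h5)
      subst hac hbd hae
      exact hf a b (fun hab => hxy (by rw [h1, h2, hab])) hl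
  · have : (S.map fun a => S.idxOf a).toFinset = S.toFinset.image fun a => S.idxOf a := by
      ext; simp
    rw [this]
    exact Finset.card_image_of_injOn fun a ha b _ h => hinj a (by simpa using ha) b h

/-- Extremal words over disjoint alphabets are concatenated; a pattern mixing the alphabets would
have to fit into two one-sided segments, padded below to four by empty ones. -/
theorem lambda_three_add_le (a b : ℕ) : lambda 3 a + lambda 3 b ≤ lambda 3 (a + b) := by
  obtain ⟨S, hS, hn, hlen⟩ := (isGreatest_lambda 3 a (by norm_num)).1
  obtain ⟨S', hS', hn', hlen'⟩ := (isGreatest_lambda 3 b (by norm_num)).1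
  rw [isDS_three_iff] at hS hS'
  have hcard : (S.map Sum.inl ++ S'.map Sum.inr : List (ℕ ⊕ ℕ)).toFinset.card = a + b := by
    rw [← hn, ← hn', ← Finset.card_disjSum]
    congr 1
    ext x
    cases x <;> simp
  have := length_le_lambda_toFinset (S := (S.map Sum.inl ++ S'.map Sum.inr : List (ℕ ⊕ ℕ))) ?_ ?_
  · rwa [hcard, List.length_append, List.length_map, List.length_map, hlen, hlen'] at this
  · rw [List.isChain_append]
    refine ⟨?_, ?_, ?_⟩
    · rw [List.isChain_map]
      exact hS.1.imp fun _ _ h => by simpa using h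
    · rw [List.isChain_map]
      exact hS'.1.imp fun _ _ h => by simpa using h
    · intro x hx y hy
      have hx' := List.mem_of_getLast? hx
      have hy' := List.mem_of_mem_head? hy
      obtain ⟨x, -, rfl⟩ := List.mem_map.1 hx'
      obtain ⟨y, -, rfl⟩ := List.mem_map.1 hy'
      simp
  · intro x y hxy h
    rcases x with x | x <;> rcases y with y | y
    · have h1 := h.filterMap Sum.getLeft?
      simp [List.filterMap_append, List.filterMap_map, Function.comp_def] at h1
      exact hS.2 x y (by simpa using hxy) h1
    · rw [← List.append_nil (S'.map _), ← List.append_nil (S'.map _ ++ [])] at h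
      simp only [List.append_assoc] at h
      exact not_sublist_of_four_segments (by simp) (by simp) (by simp) (by simp) h
    · rw [← List.append_nil (S'.map _), ← List.append_nil (S'.map _ ++ [])] at h
      simp only [List.append_assoc] at h
      exact not_sublist_of_four_segments (by simp) (by simp) (by simp) (by simp) h
    · have h1 := h.filterMap Sum.getRight?
      simp [List.filterMap_append, List.filterMap_map, Function.comp_def] at h1
      exact hS'.2 x y (by simpa using hxy) h1

theorem lambda_three_mono : Monotone (lambda 3) := by
  intro a b h
  obtain ⟨c, rfl⟩ := Nat.exists_eq_add_of_le h
  exact (Nat.le_add_right _ _).trans (lambda_three_add_le a c)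

theorem mul_lambda_three_le (q a : ℕ) : q * lambda 3 a ≤ lambda 3 (q * a) := by
  induction q with
  | zero => simp
  | succ q ih =>
    rw [add_mul, add_mul, one_mul, one_mul]
    exact (Nat.add_le_add_right ih _).trans (lambda_three_add_le _ _)

/-- With f blocks, the block size 4d+8 gives N = 2(d+2)f letters and length (2d+3)N. Deleting
adjacent equal letters costs at most 2(d+1)f + 2f = N. -/
theorem le_lambda_three_of_blockCount (d : ℕ) :
    2 * (d + 1) * (2 * (d + 2) * blockCount d (4 * d + 8)) ≤
      lambda 3 (2 * (d + 2) * blockCount d (4 * d + 8)) := by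
  classical
  obtain ⟨α, Z, hZ⟩ := exists_isRich d (4 * d + 8)
  set f := blockCount d (4 * d + 8)
  obtain ⟨T, hT, hTc⟩ := hZ.card
  obtain ⟨S, hSZ, hSc, hSl⟩ := exists_isChain_sublist (Item.flat Z)
  have h1 := length_le_lambda_toFinset hSc fun x y hxy h => hZ.free x y hxy (h.trans hSZ)
  have h2 := Item.adjEq_flat_le Z fun B hB => (hZ.block B hB).2
  rw [hZ.blocks_eq] at h2
  have h3 := hZ.repeats_le
  have h4 := hZ.length_eq
  have h5 : S.toFinset.card ≤ 2 * (d + 2) * f := by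
    refine (Finset.card_le_card fun a ha => hT a (hSZ.subset (List.mem_toFinset.1 ha))).trans ?_
    linarith
  refine le_trans ?_ (h1.trans (lambda_three_mono h5))
  nlinarith

/-! ### Growth of the number of blocks -/

theorem two_mul_le_ackHierarchy (k z : ℕ) : 2 * z ≤ ackHierarchy (k + 1) z := by
  induction k generalizing z with
  | zero => simp [ackHierarchy]
  | succ k ih =>
    cases z with
    | zero => simp
    | succ z =>
      rw [ackHierarchy_succ_succ]
      have h1 := ih (ackHierarchy (k + 2) z)
      have h2 : z < ackHierarchy (k + 2) z := by
        rcases Nat.eq_zero_or_pos z with rfl | hz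
        · simp [ackHierarchy]
        · exact (ackHierarchy_strictMono (k + 1)).2 z hz
      omega

theorem two_pow_mul_ackHierarchy_le (k y j : ℕ) :
    2 ^ j * ackHierarchy (k + 2) y ≤ ackHierarchy (k + 2) (y + j) := by
  induction j with
  | zero => simp
  | succ j ih =>
    rw [← add_assoc, ackHierarchy_succ_succ, pow_succ', mul_assoc]
    exact (Nat.mul_le_mul_left 2 ih).trans (two_mul_le_ackHierarchy k _)

theorem two_pow_le_ackHierarchy (k y : ℕ) : 2 ^ y ≤ ackHierarchy (k + 2) y := by
  have := two_pow_mul_ackHierarchy_le k 0 y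
  simpa [ackHierarchy] using this

theorem ackHierarchy_apply_two (k : ℕ) : ackHierarchy (k + 1) 2 = 4 := by
  induction k with
  | zero => simp [ackHierarchy]
  | succ k ih =>
    have h : ackHierarchy (k + 1) 1 = 2 := by
      clear ih
      induction k with
      | zero => simp [ackHierarchy]
      | succ k ih => simpa [ackHierarchy] using ih
    rw [ackHierarchy_succ_succ, ackHierarchy_succ_succ]
    simp only [ackHierarchy, Function.iterate_zero, id, h, ih]

theorem ackermann_add_two (k : ℕ) : ackermann (k + 2) = ackHierarchy (k + 1) 4 := by
  rw [ackermann, ackHierarchy_succ_succ, ackHierarchy_apply_two]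

theorem two_pow_le_ackermann (d : ℕ) : 16 * 2 ^ d ≤ ackermann (d + 3) := by
  induction d with
  | zero => rw [ackermann_add_two, ackHierarchy_two]; norm_num
  | succ d ih =>
    have h := two_pow_mul_ackHierarchy_le (d + 1) 3 1
    rw [show d + 1 + 3 = d + 2 + 2 by ring, ackermann_add_two]
    rw [ackermann] at ih
    rw [pow_succ]
    have h' : 2 ^ 1 * ackHierarchy (d + 3) 3 ≤ ackHierarchy (d + 3) 4 := h
    change _ ≤ ackHierarchy (d + 3) 4
    omega

theorem sq_le_two_pow {z : ℕ} (hz : 4 ≤ z) : z * z ≤ 2 ^ z := by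
  induction z, hz using Nat.le_induction with
  | base => norm_num
  | succ z hz ih => rw [pow_succ]; nlinarith

/-- With F the count at (d+1, m), the recursion gives F · `blockCount d F`, which is the quantity
bounded at level d; so one step in m is one application of A_{d+2}, as in the hierarchy. -/
theorem mul_blockCount_le (d m : ℕ) : m * blockCount d m ≤ ackHierarchy (d + 2) (m + 5) := by
  induction d generalizing m with
  | zero =>
    rw [ackHierarchy_two, blockCount, pow_add]
    have := (Nat.lt_two_pow_self (n := m)).le
    omega
  | succ d ih =>
    -- Of the 6, five match the shift in `ih`; the sixth doubles the bound, leaving room to restore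
    -- the summand 6.
    have key : ∀ m, blockCount (d + 1) m + 6 ≤ ackHierarchy (d + 3) (m + 4) := by
      intro m
      induction m with
      | zero =>
        have := two_pow_le_ackHierarchy (d + 1) 4
        rw [blockCount, zero_add]
        exact le_trans (by norm_num) this
      | succ m ihm =>
        set F := blockCount (d + 1) m with hF
        rw [blockCount, ← hF, show m + 1 + 4 = m + 4 + 1 by ring, ackHierarchy_succ_succ]
        refine le_trans ?_ ((ackHierarchy_strictMono (d + 1)).1.monotone ihm)
        have h1 := ih F
        have h2 := two_pow_mul_ackHierarchy_le d (F + 5) 1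
        have h3 := two_pow_le_ackHierarchy d (F + 5)
        have h4 : 2 ^ 5 ≤ 2 ^ (F + 5) := Nat.pow_le_pow_right (by norm_num) (by omega)
        have h5 : 2 ^ 1 * ackHierarchy (d + 2) (F + 5) ≤ ackHierarchy (d + 2) (F + 6) := h2
        have h6 : F * blockCount d F + 6 ≤ ackHierarchy (d + 2) (F + 6) := by omega
        exact h6
    rw [show m + 5 = m + 4 + 1 by ring, ackHierarchy_succ_succ]
    set z := ackHierarchy (d + 1 + 2) (m + 4) with hz
    have h1 : blockCount (d + 1) m + 6 ≤ z := key m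
    have h2 : 2 ^ (m + 4) ≤ z := two_pow_le_ackHierarchy (d + 1) (m + 4)
    have h3 := (Nat.lt_two_pow_self (n := m + 4)).le
    have h4 : m * blockCount (d + 1) m ≤ z * z := Nat.mul_le_mul (by omega) (by omega)
    exact h4.trans ((sq_le_two_pow (by omega)).trans (two_pow_le_ackHierarchy d z))

theorem mul_blockCount_le_ackermann (d : ℕ) :
    (d + 1) * (2 * (d + 2) * blockCount d (4 * d + 8)) ≤ ackermann (d + 4) := by
  have h1 := mul_blockCount_le d (4 * d + 8)
  have h2 := two_pow_mul_ackHierarchy_le d (4 * d + 8 + 5) (d + 1)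
  have h3 := two_pow_le_ackermann d
  have h4 := (Nat.lt_two_pow_self (n := d + 1)).le
  have h5 : ackermann (d + 4) = ackHierarchy (d + 2) (ackermann (d + 3)) := by
    rw [show d + 4 = d + 2 + 2 by ring, ackermann_add_two, ackermann, ← ackHierarchy_succ_succ]
  rw [h5]
  have h6 : 4 * d + 8 + 5 + (d + 1) ≤ ackermann (d + 3) := by
    have := Nat.lt_two_pow_self (n := d)
    omega
  refine le_trans ?_ (h2.trans ((ackHierarchy_strictMono (d + 1)).1.monotone h6))
  refine Nat.mul_le_mul h4 (le_trans ?_ h1)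
  gcongr
  omega

/-- The lower bound for `λ₃`. -/
theorem le_lambda_three {n d : ℕ} (h : ackermann (d + 4) < n) : 2 * d * n ≤ lambda 3 n := by
  set M := 2 * (d + 2) * blockCount d (4 * d + 8) with hM
  have h1 := (mul_blockCount_le_ackermann d).trans h.le
  have h2 := le_lambda_three_of_blockCount d
  rw [← hM] at h1 h2
  have hMpos : 0 < M := by
    have := two_le_blockCount d (4 * d + 8)
    rw [hM]
    positivity
  have h3 := (Nat.mul_le_mul_left (n / M) h2).trans (mul_lambda_three_le (n / M) M)
  have h4 := h3.trans (lambda_three_mono (Nat.div_mul_le_self n M))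
  have h5 := Nat.div_add_mod n M
  have h6 := Nat.mod_lt n hMpos
  refine le_trans ?_ h4
  have h7 : n ≤ n / M * M + M := by rw [mul_comm]; omega
  have h8 := Nat.mul_le_mul_left (2 * (d + 1)) h7
  -- Since (d+1)M ≤ n, the rounding loss 2(d+1)M is at most 2n: the coefficient drops from 2(d+1) to
  -- 2d.
  nlinarith

/-! ### Comparison with α and the limit -/

theorem tendsto_alpha : Tendsto (fun n : ℕ => alpha (n : ℝ)) atTop atTop := by
  rw [tendsto_atTop]
  intro K
  filter_upwards [eventually_gt_atTop (∑ j ∈ Finset.range K, ackermann j)] with n hn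
  by_contra h
  have h1 := (alpha_spec (n : ℝ)).1.2
  have h2 : ackermann (alpha (n : ℝ)) ≤ ∑ j ∈ Finset.range K, ackermann j :=
    Finset.single_le_sum (f := ackermann) (fun _ _ => Nat.zero_le _)
      (Finset.mem_range.2 (not_le.1 h))
  have h3 : n ≤ ackermann (alpha (n : ℝ)) := by exact_mod_cast h1
  omega

theorem alpha_mul_le_lambda_three {n : ℕ} (h : 5 ≤ alpha (n : ℝ)) :
    2 * ((alpha (n : ℝ) : ℝ) - 5) * n ≤ lambda 3 n := by
  obtain ⟨d, hd⟩ := Nat.exists_eq_add_of_le' h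
  have h1 : ackermann (d + 4) < n := by
    by_contra h2
    have : alpha (n : ℝ) ≤ d + 4 :=
      (alpha_spec (n : ℝ)).2 ⟨by omega, by exact_mod_cast not_lt.1 h2⟩
    omega
  have h2 := le_lambda_three h1
  rw [hd]
  push_cast
  rw [add_sub_cancel_right]
  exact_mod_cast h2

/-- Choosing 2^e ≤ 2x ≤ 4n/l turns the error 9α·2^e into 36αn/l, and (x+1)l ≤ 3n bounds the deleted
positions by 3(1+2l)n. -/
theorem lambda_three_le_alpha_mul {n l : ℕ} (hl : 8 ≤ l) (hn : l ≤ n)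
    (h : 2 ≤ alpha (n : ℝ)) :
    (lambda 3 n : ℝ) ≤ (2 * alpha (n : ℝ) + 36 * alpha (n : ℝ) / l + 3 * (1 + 2 * l)) * n := by
  obtain ⟨k, hk⟩ := Nat.exists_eq_add_of_le' h
  have hA : n ≤ ackermann (k + 2) := by
    have := (alpha_spec (n : ℝ)).1.2
    rw [hk] at this
    exact_mod_cast this
  set x := 2 * n / l with hx
  have hxl : x * l ≤ 2 * n := Nat.div_mul_le_self _ _
  have hx0 : x ≠ 0 := (Nat.div_pos (by omega) (by omega)).ne'
  set e := Nat.log 2 x + 1 with he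
  have he1 : x < 2 ^ e := Nat.lt_pow_succ_log_self (by norm_num) x
  have he2 : 2 ^ e ≤ 2 * x := by
    rw [he, pow_succ']
    exact Nat.mul_le_mul_left 2 (Nat.pow_log_le_self 2 hx0)
  have he3 : 2 ^ e ≤ ackHierarchy (k + 2) 3 := by
    refine le_trans ?_ hA
    have := Nat.mul_le_mul_left x hl
    omega
  have h1 := lambda_three_le (by omega : 0 < l) he1 he3
  have h2 : lambda 3 n ≤
      2 * (k + 2) * n + 9 * (k + 2) * (2 * x) + (x + 1) * (l + 2 * (l * l)) :=
    h1.trans (by gcongr)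
  have h3 : (lambda 3 n : ℝ) ≤
      2 * (k + 2) * n + 9 * (k + 2) * (2 * x) + (x + 1) * (l + 2 * (l * l)) := by
    exact_mod_cast h2
  have hl0 : (0 : ℝ) < l := by exact_mod_cast (by omega : 0 < l)
  have hxr : (x : ℝ) ≤ 2 * n / l := by
    rw [le_div_iff₀ hl0]
    exact_mod_cast hxl
  have h4 : ((x : ℝ) + 1) * (l + 2 * (l * l)) ≤ 3 * n * (1 + 2 * l) := by
    have h5 : ((x : ℝ) + 1) * l ≤ 3 * n := by
      have : (x + 1) * l ≤ 3 * n := by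
        rw [add_mul]
        omega
      exact_mod_cast this
    calc ((x : ℝ) + 1) * (l + 2 * (l * l)) = ((x + 1) * l) * (1 + 2 * l) := by ring
      _ ≤ _ := by gcongr
  have h6 : (9 * ((k : ℝ) + 2) * (2 * x)) ≤ 9 * (k + 2) * (2 * (2 * n / l)) := by gcongr
  have h7 : 9 * ((k : ℝ) + 2) * (2 * (2 * n / l)) = 36 * (k + 2) / l * n := by ring
  rw [hk]
  push_cast
  linarith

end DavenportSchinzel

theorem mainTheorem7 :
    Tendsto (fun n : ℕ => (DavenportSchinzel.lambda 3 n : ℝ) /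
      ((n : ℝ) * (DavenportSchinzel.alpha (n : ℝ) : ℝ))) atTop (𝓝 2) := by
  have halpha : Tendsto (fun n : ℕ => (DavenportSchinzel.alpha (n : ℝ) : ℝ)) atTop atTop :=
    tendsto_natCast_atTop_atTop.comp DavenportSchinzel.tendsto_alpha
  have hdiv : ∀ C : ℝ, Tendsto (fun n : ℕ => C / (DavenportSchinzel.alpha (n : ℝ) : ℝ)) atTop (𝓝 0) := fun C =>
    halpha.const_div_atTop C
  rw [tendsto_order]
  constructor
  · intro b hb
    filter_upwards [DavenportSchinzel.tendsto_alpha.eventually_ge_atTop 5, eventually_gt_atTop 0,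
      (hdiv 10).eventually_lt_const (sub_pos.2 hb)] with n h5 hn hlt
    have h1 := DavenportSchinzel.alpha_mul_le_lambda_three h5
    have hn' : (0 : ℝ) < n := by exact_mod_cast hn
    have ha : (0 : ℝ) < DavenportSchinzel.alpha (n : ℝ) := by exact_mod_cast (by omega : 0 < DavenportSchinzel.alpha (n : ℝ))
    rw [div_lt_iff₀ ha] at hlt
    rw [lt_div_iff₀ (by positivity)]
    refine lt_of_lt_of_le ?_ h1
    have : b * (n * (DavenportSchinzel.alpha (n : ℝ) : ℝ)) = b * DavenportSchinzel.alpha (n : ℝ) * n := by ring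
    rw [this]
    exact mul_lt_mul_of_pos_right (by linarith) hn'
  · intro b hb
    -- Half of the gap b - 2 pays for 36/l with l fixed, the other half for 3(1+2l)/α(n), which
    -- tends to 0.
    obtain ⟨l, hl⟩ := exists_nat_gt (max 8 (36 / ((b - 2) / 2)))
    have hb2 : 0 < (b - 2) / 2 := by linarith
    have hl8 : 8 ≤ l := by exact_mod_cast ((le_max_left _ _).trans_lt hl).le
    have hl0 : (0 : ℝ) < l := by exact_mod_cast (by omega : 0 < l)
    have hle : 36 / (l : ℝ) < (b - 2) / 2 := by
      have := (le_max_right _ _).trans_lt hl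
      rw [div_lt_iff₀ hb2] at this
      rw [div_lt_iff₀ hl0]
      linarith
    filter_upwards [DavenportSchinzel.tendsto_alpha.eventually_ge_atTop 2, eventually_ge_atTop l,
      (hdiv (3 * (1 + 2 * l))).eventually_lt_const hb2] with n h2 hn hlt
    have h1 := DavenportSchinzel.lambda_three_le_alpha_mul hl8 hn h2
    have hn' : (0 : ℝ) < n := by exact_mod_cast (by omega : 0 < n)
    have ha : (0 : ℝ) < DavenportSchinzel.alpha (n : ℝ) := by exact_mod_cast (by omega : 0 < DavenportSchinzel.alpha (n : ℝ))
    rw [div_lt_iff₀ ha] at hlt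
    rw [div_lt_iff₀ (by positivity)]
    refine lt_of_le_of_lt h1 ?_
    have h3 : b * (n * (DavenportSchinzel.alpha (n : ℝ) : ℝ)) = b * DavenportSchinzel.alpha (n : ℝ) * n := by ring
    have h4 : 36 * (DavenportSchinzel.alpha (n : ℝ) : ℝ) / l = 36 / l * DavenportSchinzel.alpha (n : ℝ) := by ring
    have h5 := mul_lt_mul_of_pos_right hle ha
    rw [h3, h4]
    exact mul_lt_mul_of_pos_right (by linarith) hn'
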